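/- **Model.** Let $(Y,Z,W)$ be a random vector with values in $\mathbb R\times\mathbb R^{d_z}\times\mathbb R^{d_w}$ such that $Y=\varphi(Z)+U$, where $U$ is integrable with $E[U\mid W]=0$ and $\varphi\in L^2_Z=\{\phi: E|\phi(Z)|^2<\infty\}$. Let $(Y_i,Z_i,W_i)$, $i\ge 1$, be independent copies of $(Y,Z,W)$. Let $W$ have Lebesgue density $p_W$, and let $\mathcal W$ be the support of $W$. Let $\nu$ be a probability density on $\mathbb R^{d_w}$, and let $(f_j)_{j\ge1}$ be an orthonormal basis of $L^2_\nu(\mathbb R^{d_w})=\{\phi:\int\phi^2(s)\nu(s)\,ds<\infty\}$. **Assumptions.** - (A1) There are constants $\eta_f,\eta_p\ge1$ with $\sup_{j}\int|f_j(s)|^4\nu(s)\,ds\le\eta_f$ and $\sup_{w\in\mathcal W}p_W(w)/\nu(w)\le\eta_p$, where $\nu>0$ on $\mathcal W$. - (A2) There is a constant $\sigma>0$ with $E[U^4\mid W]\le\sigma^4$ almost surely (in particular $E[U^4]<\infty$). - (A3) The conditional expectation operator $T\phi=E[\phi(Z)\mid W]$, from $L^2_Z$ to $L^2_W=\{\psi:E|\psi(W)|^2<\infty\}$,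 is nonsingular, that is, its null space is trivial. - (A4) The real sequence $\tau=(\tau_j)_{j\ge1}$ is positive and nonincreasing, with $\tau_1=1$. **Test statistic.** For a known function $\varphi_0$ and integers $m_n$ put $$S_n=\sum_{j=1}^{m_n}\tau_j\Big|\frac1n\sum_{i=1}^n\big(Y_i-\varphi_0(Z_i)\big)f_j(W_i)\Big|^2 .$$ Let $f_j^\tau=\sqrt{\tau_j}\,f_j$ and let $\varSigma$ be the infinite covariance matrix of $(Uf_j^\tau(W))_{j\ge1}$. **Theorem.** Let (A1)–(A4) hold, and suppose that $\sum_{j=1}^{m_n}\tau_j=O(1)$ and $m_n\to\infty$ as $n\to\infty$. Then $\varSigma$, acting on $\ell^2$, has a sequence $(\lambda_j)_{j\ge1}$ of ordered eigenvalues: a nonnegative, nonincreasing sequence in which every nonzero real number $x$ occurs exactly $\dim\{v\in\ell^2:\varSigma v=xv\}$ times (continued by zeros if $\varSigma$ has only finitely many nonzero eigenvalues, counted with multiplicity). Moreover, under the null hypothesis $H_0:\varphi=\varphi_0$ (in $L^2_Z$), if $(\chi^2_{1j})_{j\ge1}$ are independent random variables, each chi-square distributed with one degree of freedom, then the series $\sum_{j=1}^\infty\lambda_j\chi^2_{1j}$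 converges almost surely and $$nS_n\ \xrightarrow{\ d\ }\ \sum_{j=1}^\infty\lambda_j\,\chi^2_{1j}\qquad(n\to\infty).$$ -/

import Mathlib

open MeasureTheory ProbabilityTheory Filter Topology Asymptotics

/-- The measure `ν(s) ds` on `ℝ^d` with Lebesgue density `ν`. -/
noncomputable def densityMeasure {d : ℕ} (ν : EuclideanSpace ℝ (Fin d) → ℝ) :
    Measure (EuclideanSpace ℝ (Fin d)) :=
  volume.withDensity (fun s => ENNReal.ofReal (ν s))

/-- `p` is a (Lebesgue) density of the random vector `W`. -/
structure IsDensityOf {Ω : Type*} [MeasurableSpace Ω] {d : ℕ}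
    (p : EuclideanSpace ℝ (Fin d) → ℝ) (W : Ω → EuclideanSpace ℝ (Fin d))
    (P : Measure Ω) : Prop where
  measurable : Measurable p
  nonneg : ∀ w, 0 ≤ p w
  map_eq : P.map W = densityMeasure p

/-- `ν` is a probability density function on `ℝ^d`. -/
structure IsProbDensity {d : ℕ} (ν : EuclideanSpace ℝ (Fin d) → ℝ) : Prop where
  measurable : Measurable ν
  nonneg : ∀ w, 0 ≤ ν w
  lintegral_eq_one : ∫⁻ s, ENNReal.ofReal (ν s) = 1

/-- The functions `f 0, f 1, …` form an orthonormal basis of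
`L²_ν(ℝ^d) = {φ : ∫ φ(s)² ν(s) ds < ∞}`. -/
def IsOrthonormalBasisL2 {d : ℕ} (ν : EuclideanSpace ℝ (Fin d) → ℝ)
    (f : ℕ → EuclideanSpace ℝ (Fin d) → ℝ) : Prop :=
  (∀ l, Measurable (f l)) ∧
    ∃ b : HilbertBasis ℕ ℝ (Lp ℝ 2 (densityMeasure ν)),
      ∀ l, (b l : EuclideanSpace ℝ (Fin d) → ℝ) =ᵐ[densityMeasure ν] f l

/-- The support of (the law of) the random vector `W`. -/
def rvSupport {Ω : Type*} [MeasurableSpace Ω] {d : ℕ}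
    (P : Measure Ω) (W : Ω → EuclideanSpace ℝ (Fin d)) : Set (EuclideanSpace ℝ (Fin d)) :=
  (P.map W).support

/-- The moment condition on the basis functions and the domination condition on the density `pW`
of `W`: `sup_l ∫ |f_l|⁴ ν ≤ η_f`, `ν > 0` on the support of `W` and `sup pW / ν ≤ η_p` there. -/
def BasisCondition {Ω : Type*} [MeasurableSpace Ω] {d : ℕ}
    (P : Measure Ω) (W : Ω → EuclideanSpace ℝ (Fin d))
    (pW ν : EuclideanSpace ℝ (Fin d) → ℝ) (f : ℕ → EuclideanSpace ℝ (Fin d) → ℝ) : Prop :=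
  ∃ ηf ηp : ℝ, 1 ≤ ηf ∧ 1 ≤ ηp ∧
    (∀ l, Integrable (fun s => |f l s| ^ 4 * ν s) ∧ ∫ s, |f l s| ^ 4 * ν s ≤ ηf) ∧
    (∀ w ∈ rvSupport P W, 0 < ν w ∧ pW w / ν w ≤ ηp)

/-- The conditional expectation `E[X | W]` of a real random variable given the random vector `W`,
as a random variable. -/
noncomputable def condGiven {Ω : Type*} [MeasurableSpace Ω] {d : ℕ}
    (P : Measure Ω) (X : Ω → ℝ) (W : Ω → EuclideanSpace ℝ (Fin d)) : Ω → ℝ :=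
  P[X | MeasurableSpace.comap W inferInstance]

/-- Bounded conditional fourth moment: `E[U⁴ | W] ≤ σ⁴` almost surely for some `σ > 0`. -/
def CondFourthMomentBounded {Ω : Type*} [MeasurableSpace Ω] {d : ℕ}
    (P : Measure Ω) (U : Ω → ℝ) (W : Ω → EuclideanSpace ℝ (Fin d)) : Prop :=
  Integrable (fun ω => U ω ^ 4) P ∧
    ∃ σ : ℝ, 0 < σ ∧ ∀ᵐ ω ∂P, condGiven P (fun ω => U ω ^ 4) W ω ≤ σ ^ 4

/-- The conditional expectation operator `T φ = E[φ(Z) | W]`, from `L²_Z` to `L²_W`. An element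
`ψ` of `L²_W` is represented by the random variable `ψ(W)`. -/
noncomputable def condExpOp {Ω : Type*} [MeasurableSpace Ω] {dz dw : ℕ}
    (P : Measure Ω) (Z : Ω → EuclideanSpace ℝ (Fin dz)) (W : Ω → EuclideanSpace ℝ (Fin dw))
    (φ : EuclideanSpace ℝ (Fin dz) → ℝ) : Ω → ℝ :=
  condGiven P (fun ω => φ (Z ω)) W

/-- `T` is nonsingular: its null space in `L²_Z` is trivial. -/
def CondExpOpNonsingular {Ω : Type*} [MeasurableSpace Ω] {dz dw : ℕ}
    (P : Measure Ω) (Z : Ω → EuclideanSpace ℝ (Fin dz))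
    (W : Ω → EuclideanSpace ℝ (Fin dw)) : Prop :=
  ∀ φ : EuclideanSpace ℝ (Fin dz) → ℝ, MemLp φ 2 (P.map Z) →
    condExpOp P Z W φ =ᵐ[P] 0 → φ =ᵐ[P.map Z] 0

/-- The weights are positive, nonincreasing, with first weight one (indices start at `0`). -/
def WeightCondition (τ : ℕ → ℝ) : Prop :=
  (∀ j, 0 < τ j) ∧ Antitone τ ∧ τ 0 = 1

/-- The nonparametric instrumental regression model `Y = φ(Z) + U`, `E[U | W] = 0`,
with `φ ∈ L²_Z`; the error is `U = Y - φ(Z)`. -/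
structure IsNPIVModel {Ω : Type*} [MeasurableSpace Ω] {dz dw : ℕ} (P : Measure Ω)
    (Y : Ω → ℝ) (Z : Ω → EuclideanSpace ℝ (Fin dz)) (W : Ω → EuclideanSpace ℝ (Fin dw))
    (φ : EuclideanSpace ℝ (Fin dz) → ℝ) (U : Ω → ℝ) : Prop where
  measurable_Y : Measurable Y
  measurable_Z : Measurable Z
  measurable_W : Measurable W
  measurable_φ : Measurable φ
  memLp_φ : MemLp φ 2 (P.map Z)
  error_eq : ∀ ω, Y ω = φ (Z ω) + U ω
  integrable_error : Integrable U P
  condExp_error : condGiven P U W =ᵐ[P] 0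

/-- `(Y i, Z i, W i)`, `i = 0, 1, …`, are independent copies of `(Y₀, Z₀, W₀)`. -/
def IsIIDSample {Ω Ω₀ : Type*} [MeasurableSpace Ω] [MeasurableSpace Ω₀] {dz dw : ℕ}
    (P : Measure Ω) (Y : ℕ → Ω → ℝ) (Z : ℕ → Ω → EuclideanSpace ℝ (Fin dz))
    (W : ℕ → Ω → EuclideanSpace ℝ (Fin dw))
    (P₀ : Measure Ω₀) (Y₀ : Ω₀ → ℝ) (Z₀ : Ω₀ → EuclideanSpace ℝ (Fin dz))
    (W₀ : Ω₀ → EuclideanSpace ℝ (Fin dw)) : Prop :=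
  iIndepFun (fun i ω => (Y i ω, Z i ω, W i ω)) P ∧
    ∀ i, IdentDistrib (fun ω => (Y i ω, Z i ω, W i ω)) (fun ω => (Y₀ ω, Z₀ ω, W₀ ω)) P P₀

/-- The goodness-of-fit statistic
`S_n = ∑_{j ≤ m} τ_j |n⁻¹ ∑_{i ≤ n} (Y_i - φ₀(Z_i)) f_j(W_i)|²`. -/
noncomputable def testStat {Ω : Type*} {dz dw : ℕ}
    (Y : ℕ → Ω → ℝ) (Z : ℕ → Ω → EuclideanSpace ℝ (Fin dz))
    (W : ℕ → Ω → EuclideanSpace ℝ (Fin dw))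
    (φ₀ : EuclideanSpace ℝ (Fin dz) → ℝ) (f : ℕ → EuclideanSpace ℝ (Fin dw) → ℝ)
    (τ : ℕ → ℝ) (m n : ℕ) (ω : Ω) : ℝ :=
  ∑ j ∈ Finset.range m, τ j *
    |(n : ℝ)⁻¹ * ∑ i ∈ Finset.range n, (Y i ω - φ₀ (Z i ω)) * f j (W i ω)| ^ 2

/-- The weighted basis functions `f_j^τ = √τ_j f_j`. -/
noncomputable def weightedBasis {d : ℕ} (τ : ℕ → ℝ) (f : ℕ → EuclideanSpace ℝ (Fin d) → ℝ)
    (j : ℕ) (w : EuclideanSpace ℝ (Fin d)) : ℝ :=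
  √(τ j) * f j w

/-- The infinite covariance matrix of `(U f_j^τ(W))_j`. -/
noncomputable def covMatrix {Ω : Type*} [MeasurableSpace Ω] {d : ℕ}
    (P : Measure Ω) (U : Ω → ℝ) (W : Ω → EuclideanSpace ℝ (Fin d))
    (τ : ℕ → ℝ) (f : ℕ → EuclideanSpace ℝ (Fin d) → ℝ) : Matrix ℕ ℕ ℝ :=
  fun j l => covariance (fun ω => U ω * weightedBasis τ f j (W ω))
    (fun ω => U ω * weightedBasis τ f l (W ω)) P

/-- The eigenspace in `ℓ²` of an infinite matrix `S`: all `v ∈ ℓ²` with `S v = x v`, i.e.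
`∑_l S_{jl} v_l = x v_j` for all `j`. -/
def matrixEigenspace (S : Matrix ℕ ℕ ℝ) (x : ℝ) : Submodule ℝ (lp (fun _ : ℕ => ℝ) 2) where
  carrier := {v | ∀ j, HasSum (fun l => S j l * v l) (x * v j)}
  add_mem' := by
    intro v w hv hw j
    have h := (hv j).add (hw j)
    simpa [mul_add] using h
  zero_mem' := by
    intro j
    simp [hasSum_zero]
  smul_mem' := by
    intro c v hv j
    have h := (hv j).mul_left c
    simpa [mul_left_comm] using h

/-- `lam` is the sequence of ordered eigenvalues of the (positive semidefinite) infinite matrix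
`S`: it is nonnegative and nonincreasing, and each nonzero real number `x` occurs in it exactly as
often as the dimension of the eigenspace of `S` at `x`. (If `S` has only finitely many nonzero
eigenvalues, counted with multiplicity, the sequence continues with zeros.) -/
structure IsOrderedEigenvalues (S : Matrix ℕ ℕ ℝ) (lam : ℕ → ℝ) : Prop where
  nonneg : ∀ j, 0 ≤ lam j
  antitone : Antitone lam
  multiplicity : ∀ x : ℝ, x ≠ 0 →
    Cardinal.mk {j : ℕ | lam j = x} = Module.rank ℝ (matrixEigenspace S x)

/-- The chi-square distribution with one degree of freedom: the law of the square of a standard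
normal random variable. -/
noncomputable def chiSquareOne : Measure ℝ :=
  (gaussianReal 0 1).map (fun x => x ^ 2)

/-!
The statistic is a truncated squared norm in `ℓ²`. Under the null hypothesis the residuals
`Y_i - φ₀(Z_i)` are copies of `U`, so with `X_i = ((Y_i - φ₀(Z_i)) f_j^τ(W_i))_j` the quantity
`n S_n` is the sum of the squares of the first `m_n` coordinates of `n^{-1/2} (X_1 + ⋯ + X_n)`.

The vectors `X_i` are centred because `E[U | W] = 0`, and `E[(U f_j(W))²] ≤ (E U⁴ + E f_j(W)⁴) / 2`
is bounded in `j` by the fourth moment conditions, so that `E ‖X_i‖²` is at most a multiple of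
`∑ τ_j < ∞` (`moments_error_mul_weightedBasis`). Hence the `X_i` are square-integrable random
vectors of `ℓ²`, and `Σ` is the matrix of their covariance operator `C`, with the same eigenspaces
(`matrixEigenspace_eq_eigenspace`).

The operator `C` is an average of rank-one operators, hence compact
(`isCompactOperator_covarianceOperator`), and its trace is `E ‖X_i‖² < ∞`. The spectral theorem then
yields the ordered eigenvalues: an orthonormal family of eigenvectors has summable eigenvalues,
which can be rearranged in decreasing order (`exists_antitone_rearrangement`,
`exists_orderedEigenvalues_covarianceOperator`).

For the limit law, fix orthonormal eigenvectors `e_j` for the eigenvalues `λ_j`. By the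
one-dimensional central limit theorem and Lévy's convergence theorem, the first `k`
eigen-coordinates of the normalized sum converge jointly to independent `N(0, λ_j)` variables, so the
sum of their squares converges to `∑_{j<k} λ_j χ²_j` (`tendsto_charFun_sum_sq_inner`). The remaining
coordinates contribute in mean exactly the tail `∑_{j≥k} λ_j` of the trace, uniformly in `n`, and so
does the tail of the limiting series; comparing characteristic functions gives
`‖n^{-1/2} (X_1 + ⋯ + X_n)‖² → ∑ λ_j χ²_j` (`tendstoInDistribution_norm_sq_normalizedSum`).
Truncation at `m_n → ∞` coordinates costs in mean a tail of the trace computed in the standard basis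
(`tendstoInMeasure_truncation`), which Slutsky's theorem absorbs.
-/

/-! ### Covariance operators on a separable Hilbert space -/

section CovarianceOperator

open scoped InnerProductSpace

theorem integrable_inner_sq {H : Type*} [NormedAddCommGroup H] [InnerProductSpace ℝ H]
    [MeasurableSpace H] {μ : Measure H} (hμ : MemLp id 2 μ) (v : H) :
    Integrable (fun x : H => ⟪v, x⟫_ℝ ^ 2) μ :=
  (hμ.const_inner v).integrable_sq

theorem inner_covarianceOperator_self {H : Type*} [NormedAddCommGroup H] [InnerProductSpace ℝ H]
    [CompleteSpace H] [MeasurableSpace H] [BorelSpace H]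
    {μ : Measure H} (hμ : MemLp id 2 μ) (v : H) :
    ⟪covarianceOperator μ v, v⟫_ℝ = ∫ x, ⟪v, x⟫_ℝ ^ 2 ∂μ := by
  simp_rw [covarianceOperator_inner hμ, pow_two]

theorem Orthonormal.countable_of_secondCountable {H : Type*} [NormedAddCommGroup H]
    [InnerProductSpace ℝ H] [SecondCountableTopology H] {ι : Type*}
    {v : ι → H} (hv : Orthonormal ℝ v) :
    Countable ι := by
  refine Pairwise.countable_of_isOpen_disjoint (s := fun i => Metric.ball (v i) (1 / 2)) ?_
    (fun i => Metric.isOpen_ball) (fun i => ⟨v i, Metric.mem_ball_self (by norm_num)⟩)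
  intro i j hij
  refine Metric.ball_disjoint_ball ?_
  have h : dist (v i) (v j) ^ 2 = 2 := by
    rw [dist_eq_norm, @norm_sub_sq_real, hv.1, hv.1, hv.2 hij]; norm_num
  nlinarith [dist_nonneg (x := v i) (y := v j)]

variable {H : Type*} [NormedAddCommGroup H] [InnerProductSpace ℝ H] [CompleteSpace H]
  [MeasurableSpace H] [BorelSpace H]

/-- The covariance operator of a probability measure with finite second moment is compact: it is
the average of the rank-one operators `u ↦ ⟪x, u⟫ x`, and the compact operators form a closed
convex set. -/
theorem isCompactOperator_covarianceOperator [SecondCountableTopology H]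
    {μ : Measure H} [IsProbabilityMeasure μ]
    (hμ : MemLp id 2 μ) : IsCompactOperator (covarianceOperator μ) := by
  have hmeas : AEStronglyMeasurable (fun x : H => InnerProductSpace.rankOne ℝ x x) μ := by
    have : Continuous (fun x : H => InnerProductSpace.rankOne ℝ x x) :=
      (InnerProductSpace.rankOne ℝ (E := H) (F := H)).continuous.clm_apply continuous_id
    exact this.aestronglyMeasurable
  have hsq : Integrable (fun x : H => ‖x‖ ^ 2) μ := hμ.integrable_norm_pow two_ne_zero
  have hint : Integrable (fun x : H => InnerProductSpace.rankOne ℝ x x) μ := by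
    refine hsq.mono' hmeas (ae_of_all _ fun x => ?_)
    simp [pow_two]
  have heq : covarianceOperator μ = ∫ x, InnerProductSpace.rankOne ℝ x x ∂μ := by
    ext u
    rw [covarianceOperator_apply hμ, ContinuousLinearMap.integral_apply hint]
    simp [InnerProductSpace.rankOne_apply, real_inner_comm]
  have hconv : Convex ℝ {T : H →L[ℝ] H | IsCompactOperator T} :=
    (compactOperator (RingHom.id ℝ) H H).convex
  have := hconv.integral_mem (μ := μ) (f := fun x : H => InnerProductSpace.rankOne ℝ x x)
    isClosed_setOfPred_isCompactOperator (ae_of_all _ fun x => ?_) hint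
  · rw [heq]; exact this
  · have h1 : IsCompactOperator (innerSL ℝ x) :=
      isCompactOperator_of_locallyCompactSpace_dom (innerSL ℝ x)
    have h2 := h1.clm_comp (ContinuousLinearMap.toSpanSingleton ℝ x)
    have heq' : ⇑(InnerProductSpace.rankOne ℝ x x) =
        ContinuousLinearMap.toSpanSingleton ℝ x ∘ innerSL ℝ x := by
      funext u
      simp [InnerProductSpace.rankOne_apply]
    change IsCompactOperator _
    rwa [heq']

/-- The trace of the covariance operator, computed in a Hilbert basis, is the second moment. -/
theorem hasSum_inner_covarianceOperator {μ : Measure H} (hμ : MemLp id 2 μ) {ι : Type*}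
    [Countable ι] (b : HilbertBasis ι ℝ H) :
    HasSum (fun i => ⟪covarianceOperator μ (b i), b i⟫_ℝ) (∫ x, ‖x‖ ^ 2 ∂μ) := by
  have hpars (x : H) : HasSum (fun i => ⟪b i, x⟫_ℝ ^ 2) (‖x‖ ^ 2) := by
    have := b.hasSum_inner_mul_inner x x
    rw [real_inner_self_eq_norm_sq] at this
    refine this.congr_fun fun i => ?_
    rw [pow_two, real_inner_comm x (b i)]
  simp_rw [inner_covarianceOperator_self hμ]
  refine hasSum_integral_of_dominated_convergence (fun i x => ⟪b i, x⟫_ℝ ^ 2)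
    (fun i => (integrable_inner_sq hμ _).aestronglyMeasurable) (fun i => ae_of_all _ fun x => ?_)
    (ae_of_all _ fun x => (hpars x).summable) ?_ (ae_of_all _ hpars)
  · simp
  · simp_rw [fun x => (hpars x).tsum_eq]
    exact hμ.integrable_norm_pow two_ne_zero

theorem sum_inner_covarianceOperator_le {μ : Measure H} (hμ : MemLp id 2 μ) {ι : Type*}
    {v : ι → H} (hv : Orthonormal ℝ v) (s : Finset ι) :
    ∑ i ∈ s, ⟪covarianceOperator μ (v i), v i⟫_ℝ ≤ ∫ x, ‖x‖ ^ 2 ∂μ := by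
  simp_rw [inner_covarianceOperator_self hμ]
  rw [← integral_finsetSum _ fun i _ => integrable_inner_sq hμ _]
  refine integral_mono (integrable_finsetSum _ fun i _ => integrable_inner_sq hμ _)
    (hμ.integrable_norm_pow two_ne_zero) fun x => ?_
  simpa using hv.sum_inner_products_le x (s := s)

end CovarianceOperator

/-! ### Decreasing rearrangement of a family of reals -/

section Rearrangement

/-- If only finitely many members of a family of reals exceed any given positive bound, the positive
members can be arranged in a nonincreasing sequence with the same multiplicities, continued by zeros
if there are only finitely many: take
`lam n = sup {y > 0 | more than n members are ≥ y}`, which makes `y ≤ lam n` equivalent to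
`n < #{i | y ≤ a i}`. -/
theorem exists_antitone_rearrangement {ι : Type*} (a : ι → ℝ)
    (hfin : ∀ ε : ℝ, 0 < ε → {i | ε ≤ a i}.Finite) :
    ∃ lam : ℕ → ℝ, (∀ n, 0 ≤ lam n) ∧ Antitone lam ∧
      ∀ x : ℝ, 0 < x → {n | lam n = x}.Finite ∧ {n | lam n = x}.ncard = {i | a i = x}.ncard := by
  set N : ℝ → ℕ := fun y => {i | y ≤ a i}.ncard with hN
  have hNanti {y z : ℝ} (hy : 0 < y) (hyz : y ≤ z) : N z ≤ N y :=
    Set.ncard_le_ncard (fun i (hi : z ≤ a i) => hyz.trans hi) (hfin y hy)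
  -- the counting function is locally constant on the left of every positive point
  have hleft (y : ℝ) (hy : 0 < y) : ∃ z, 0 < z ∧ z < y ∧ {i | z ≤ a i} = {i | y ≤ a i} := by
    have hF : (a '' {i | y / 2 ≤ a i} ∩ Set.Iio y).Finite :=
      ((hfin _ (half_pos hy)).image a).inter_of_left _
    obtain ⟨m, hm⟩ : ∃ m, m < y ∧ ∀ t ∈ a '' {i | y / 2 ≤ a i} ∩ Set.Iio y, t ≤ m := by
      rcases (a '' {i | y / 2 ≤ a i} ∩ Set.Iio y).eq_empty_or_nonempty with h | h
      · exact ⟨y - 1, by linarith, by simp [h]⟩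
      · obtain ⟨m, hm, hmax⟩ := Set.exists_max_image _ id hF h
        exact ⟨m, hm.2, hmax⟩
    refine ⟨(max m (y / 2) + y) / 2, by positivity, ?_, ?_⟩
    · have : max m (y / 2) < y := max_lt hm.1 (by linarith)
      linarith
    · ext i
      simp only [Set.mem_ofPred_eq]
      have hmy : max m (y / 2) < y := max_lt hm.1 (by linarith)
      refine ⟨fun h => ?_, fun h => by linarith⟩
      by_contra! hlt
      have h1 : y / 2 ≤ a i := by linarith [le_max_right m (y / 2)]
      have := hm.2 (a i) ⟨⟨i, h1, rfl⟩, hlt⟩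
      linarith [le_max_left m (y / 2)]
  -- and, up to the members equal to `y`, on the right
  have hright (y : ℝ) (hy : 0 < y) : ∃ z, y < z ∧ {i | z ≤ a i} = {i | y < a i} := by
    have hF : (a '' {i | y ≤ a i} ∩ Set.Ioi y).Finite :=
      ((hfin _ hy).image a).inter_of_left _
    rcases (a '' {i | y ≤ a i} ∩ Set.Ioi y).eq_empty_or_nonempty with h | h
    · refine ⟨y + 1, by linarith, ?_⟩
      ext i
      simp only [Set.mem_ofPred_eq]
      refine ⟨fun h => by linarith, fun hi => ?_⟩
      exact absurd (h ▸ ⟨⟨i, hi.le, rfl⟩, hi⟩ : a i ∈ (∅ : Set ℝ)) (Set.notMem_empty _)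
    · obtain ⟨m, hm, hmin⟩ := Set.exists_min_image _ id hF h
      refine ⟨m, hm.2, ?_⟩
      ext i
      simp only [Set.mem_ofPred_eq]
      exact ⟨fun h => lt_of_lt_of_le hm.2 h, fun hi => hmin (a i) ⟨⟨i, hi.le, rfl⟩, hi⟩⟩
  set S : ℕ → Set ℝ := fun n => insert 0 {y | 0 < y ∧ n < N y} with hS
  have hbdd (n : ℕ) : BddAbove (S n) := by
    obtain ⟨M, hM⟩ := ((hfin 1 one_pos).image a).bddAbove
    refine ⟨max M 1, ?_⟩
    rintro y (rfl | ⟨hy, hn⟩)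
    · positivity
    · by_contra! hlt
      have hne : {i | y ≤ a i}.Nonempty := by
        by_contra hemp
        rw [Set.not_nonempty_iff_eq_empty] at hemp
        simp [hN, hemp] at hn
      obtain ⟨i, hi⟩ := hne
      have hi' : y ≤ a i := hi
      have : a i ≤ M := hM ⟨i, show (1 : ℝ) ≤ a i by linarith [le_max_right M 1], rfl⟩
      linarith [le_max_left M 1]
  have hne (n : ℕ) : (S n).Nonempty := ⟨0, Set.mem_insert _ _⟩
  have hkey (n : ℕ) (y : ℝ) (hy : 0 < y) : y ≤ sSup (S n) ↔ n < N y := by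
    refine ⟨fun h => ?_, fun h => le_csSup (hbdd n) (Or.inr ⟨hy, h⟩)⟩
    obtain ⟨z, hz, hzy, hset⟩ := hleft y hy
    obtain ⟨t, ht, hzt⟩ := exists_lt_of_lt_csSup (hne n) (hzy.trans_le h)
    rcases ht with rfl | ⟨_, hnt⟩
    · linarith
    · have : N z = N y := by simp only [hN, hset]
      exact this ▸ hnt.trans_le (hNanti hz hzt.le)
  refine ⟨fun n => sSup (S n), fun n => le_csSup (hbdd n) (Set.mem_insert _ _), ?_, ?_⟩
  · intro n k hnk
    refine csSup_le_csSup (hbdd n) (hne k) ?_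
    exact Set.insert_subset_insert fun y hy => ⟨hy.1, hnk.trans_lt hy.2⟩
  · intro x hx
    obtain ⟨z, hxz, hz⟩ := hright x hx
    have hIco : {n | sSup (S n) = x} = Set.Ico (N z) (N x) := by
      ext n
      simp only [Set.mem_ofPred_eq, Set.mem_Ico]
      rw [← hkey n x hx, ← not_lt, ← hkey n z (hx.trans hxz), not_le]
      refine ⟨fun h => ⟨h ▸ hxz, h.ge⟩, fun h => le_antisymm ?_ h.2⟩
      -- a value strictly above `x` would already be at least `z`
      by_contra! hlt
      have hpos := hx.trans hlt
      have h1 := (hkey n _ hpos).1 le_rfl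
      have h2 : N (sSup (S n)) ≤ N z := by
        refine Set.ncard_le_ncard ?_ (hfin z (hx.trans hxz))
        rw [hz]
        exact fun i (hi : _ ≤ a i) => hlt.trans_le hi
      exact absurd ((hkey n z (hx.trans hxz)).2 (h1.trans_le h2)) (not_le.2 h.1)
    rw [hIco]
    refine ⟨Set.finite_Ico _ _, ?_⟩
    have hsplit : {i | x ≤ a i} = {i | a i = x} ∪ {i | x < a i} := by
      ext i; simp only [Set.mem_ofPred_eq, Set.mem_union, le_iff_lt_or_eq, eq_comm, or_comm]
    have hsub : {i | a i = x} ⊆ {i | x ≤ a i} := fun i (hi : a i = x) => hi.ge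
    have hsub' : {i | x < a i} ⊆ {i | x ≤ a i} := fun i (hi : x < a i) => hi.le
    have hcard : N x = {i | a i = x}.ncard + N z := by
      simp only [hN, hz]
      rw [hsplit, Set.ncard_union_eq _ ((hfin x hx).subset hsub) ((hfin x hx).subset hsub')]
      exact Set.disjoint_left.2 fun i (h1 : a i = x) (h2 : x < a i) => absurd h2 (by simp [h1])
    rw [← Finset.coe_Ico, Set.ncard_coe_finset, Nat.card_Ico]
    omega

end Rearrangement

/-! ### Ordered eigenvalues of a covariance operator -/

section OrderedEigenvalues

open scoped InnerProductSpace
open Module.End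

variable {H : Type*} [NormedAddCommGroup H] [InnerProductSpace ℝ H] [CompleteSpace H]

/-- A sequence that lists every nonzero eigenvalue of a compact symmetric operator with its
multiplicity comes with pairwise orthogonal eigenvectors `e j`, which are unit vectors where
`lam j ≠ 0`, vanish where `lam j = 0`, and whose orthogonal complement is annihilated by the
operator. -/
theorem exists_orthogonal_eigenvectors {T : H →L[ℝ] H} (hT : IsCompactOperator T)
    (hsymm : (T : H →ₗ[ℝ] H).IsSymmetric) {lam : ℕ → ℝ}
    (hmult : ∀ x : ℝ, x ≠ 0 → Cardinal.lift (Cardinal.mk {j : ℕ | lam j = x}) =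
      Module.rank ℝ (eigenspace (T : Module.End ℝ H) x)) :
    ∃ e : ℕ → H, (∀ i j, i ≠ j → ⟪e i, e j⟫_ℝ = 0) ∧ (∀ j, lam j ≠ 0 → ‖e j‖ = 1) ∧
      (∀ j, lam j = 0 → e j = 0) ∧ (∀ j, T (e j) = lam j • e j) ∧
      ∀ x, (∀ j, ⟪e j, x⟫_ℝ = 0) → T x = 0 := by
  have hstep (x : ℝ) : ∃ u : ℕ → H, x ≠ 0 →
      (∀ j, lam j = x → u j ∈ eigenspace (T : Module.End ℝ H) x ∧ ‖u j‖ = 1) ∧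
      (∀ i j, lam i = x → lam j = x → i ≠ j → ⟪u i, u j⟫_ℝ = 0) ∧
      (∀ y, (∀ j, lam j = x → ⟪u j, y⟫_ℝ = 0) →
        ∀ v ∈ eigenspace (T : Module.End ℝ H) x, ⟪v, y⟫_ℝ = 0) := by
    by_cases hx : x = 0
    · exact ⟨0, fun h => absurd hx h⟩
    have : FiniteDimensional ℝ (eigenspace (T : Module.End ℝ H) x) :=
      ContinuousLinearMap.finite_dimensional_eigenspace hT x hx
    have hm := hmult x hx
    rw [← Module.finrank_eq_rank] at hm
    have hlt : Cardinal.mk {j : ℕ | lam j = x} < Cardinal.aleph0 := by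
      rw [← Cardinal.lift_lt_aleph0, hm]; exact Cardinal.natCast_lt_aleph0
    have hfin : Finite {j : ℕ | lam j = x} := Cardinal.lt_aleph0_iff_finite.1 hlt
    have : Fintype {j : ℕ | lam j = x} := Fintype.ofFinite _
    have hcard : Fintype.card {j : ℕ | lam j = x} =
        Module.finrank ℝ (eigenspace (T : Module.End ℝ H) x) := by
      rw [Cardinal.mk_fintype, Cardinal.lift_natCast] at hm
      exact_mod_cast hm
    let b := (stdOrthonormalBasis ℝ (eigenspace (T : Module.End ℝ H) x)).reindex
      (Fintype.equivFinOfCardEq hcard).symm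
    refine ⟨fun j => if h : lam j = x then (b ⟨j, h⟩ : H) else 0, fun _ => ⟨?_, ?_, ?_⟩⟩
    · intro j hj
      simp only [hj, dif_pos]
      exact ⟨(b ⟨j, hj⟩).2, b.orthonormal.1 _⟩
    · intro i j hi hj hij
      simp only [hi, hj, dif_pos]
      exact b.orthonormal.2 (i := ⟨i, hi⟩) (j := ⟨j, hj⟩) (by simpa using hij)
    · intro y hy v hv
      have hv' := congrArg (Subtype.val) (b.sum_repr ⟨v, hv⟩)
      simp only [Submodule.coe_sum, Submodule.coe_smul] at hv'
      rw [← hv', sum_inner]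
      refine Finset.sum_eq_zero fun j _ => ?_
      have := hy j.1 j.2
      simp only [show lam j.1 = x from j.2, dif_pos] at this
      rw [real_inner_smul_left]
      exact mul_eq_zero_of_right _ this
  choose u hu using hstep
  have heig (j : ℕ) (hj : lam j ≠ 0) : T (u (lam j) j) = lam j • u (lam j) j :=
    mem_eigenspace_iff.1 ((hu _ hj).1 j rfl).1
  refine ⟨fun j => if lam j = 0 then 0 else u (lam j) j, ?_, ?_, ?_, ?_, ?_⟩
  · intro i j hij
    dsimp only
    split_ifs with hi hj hj
    · simp
    · simp
    · simp
    · by_cases h : lam i = lam j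
      · rw [h]
        exact (hu _ hj).2.1 i j h rfl hij
      · exact hsymm.orthogonalFamily_eigenspaces h ⟨_, ((hu _ hi).1 i rfl).1⟩
          ⟨_, ((hu _ hj).1 j rfl).1⟩
  · intro j hj
    simpa [hj] using ((hu _ hj).1 j rfl).2
  · intro j hj
    simp [hj]
  · intro j
    dsimp only
    split_ifs with hj
    · simp
    · exact heig j hj
  · intro x hx
    have hmem : T x ∈ (⨆ μ, eigenspace (T : Module.End ℝ H) μ)ᗮ := by
      rw [← Submodule.iInf_orthogonal, Submodule.mem_iInf]
      intro c v hv
      have hv' : T v = c • v := mem_eigenspace_iff.1 hv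
      rw [show ⟪v, T x⟫_ℝ = ⟪T v, x⟫_ℝ from (hsymm v x).symm, hv', real_inner_smul_left]
      by_cases hc : c = 0
      · simp [hc]
      · refine mul_eq_zero_of_right _ ((hu c hc).2.2 x (fun j hj => ?_) v hv)
        have := hx j
        dsimp only at this
        rwa [hj, if_neg hc] at this
    rwa [ContinuousLinearMap.orthogonalComplement_iSup_eigenspaces_eq_bot hT hsymm,
      Submodule.mem_bot] at hmem

variable [MeasurableSpace H] [BorelSpace H]

theorem isSymmetric_covarianceOperator (μ : Measure H) :
    (covarianceOperator μ : H →ₗ[ℝ] H).IsSymmetric :=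
  isPositive_covarianceOperator.isSymmetric

variable [SecondCountableTopology H]

/-- The nonzero eigenvalues of a covariance operator, repeated according to multiplicity, can be
listed in a nonincreasing sequence, continued by zeros. -/
theorem exists_orderedEigenvalues_covarianceOperator {μ : Measure H} [IsProbabilityMeasure μ]
    (hμ : MemLp id 2 μ) :
    ∃ lam : ℕ → ℝ, (∀ j, 0 ≤ lam j) ∧ Antitone lam ∧ ∀ x : ℝ, x ≠ 0 →
      Cardinal.lift (Cardinal.mk {j : ℕ | lam j = x}) =
        Module.rank ℝ (eigenspace (covarianceOperator μ : Module.End ℝ H) x) := by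
  set C := covarianceOperator μ
  have hfd (x : ℝ) (hx : x ≠ 0) : FiniteDimensional ℝ (eigenspace (C : Module.End ℝ H) x) :=
    ContinuousLinearMap.finite_dimensional_eigenspace (isCompactOperator_covarianceOperator hμ) x hx
  have hnn (x : ℝ) (v : H) (hv : v ∈ eigenspace (C : Module.End ℝ H) x) (hv0 : v ≠ 0) : 0 ≤ x := by
    have h1 : C v = x • v := mem_eigenspace_iff.1 hv
    have h2 : 0 ≤ ⟪C v, v⟫_ℝ := by
      rw [inner_covarianceOperator_self hμ]; exact integral_nonneg fun _ => sq_nonneg _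
    rw [h1, real_inner_smul_left, real_inner_self_eq_norm_sq] at h2
    exact nonneg_of_mul_nonneg_left h2 (by positivity)
  -- an orthonormal family of eigenvectors, indexed with multiplicity by all nonzero eigenvalues
  let ι := Σ x : {x : ℝ // x ≠ 0}, Fin (Module.finrank ℝ (eigenspace (C : Module.End ℝ H) x.1))
  let b (x : {x : ℝ // x ≠ 0}) : OrthonormalBasis
      (Fin (Module.finrank ℝ (eigenspace (C : Module.End ℝ H) x.1))) ℝ
      (eigenspace (C : Module.End ℝ H) x.1) :=
    haveI := hfd x.1 x.2
    stdOrthonormalBasis ℝ (eigenspace (C : Module.End ℝ H) x.1)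
  let v : ι → H := fun i => (b i.1 i.2 : H)
  have hv : Orthonormal ℝ v :=
    ((isSymmetric_covarianceOperator μ).orthogonalFamily_eigenspaces.comp
      (Subtype.val_injective (p := fun x : ℝ => x ≠ 0))).orthonormal_sigma_orthonormal
      (fun x => (b x).orthonormal)
  let a : ι → ℝ := fun i => i.1.1
  have hCv (i : ι) : ⟪C (v i), v i⟫_ℝ = a i := by
    have h1 : C (v i) = a i • v i := mem_eigenspace_iff.1 (b i.1 i.2).2
    rw [h1, real_inner_smul_left, real_inner_self_eq_norm_sq, hv.1]; simp
  have ha (i : ι) : 0 ≤ a i := hnn _ (v i) (b i.1 i.2).2 (hv.ne_zero i)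
  have hsum : Summable a := by
    refine summable_of_sum_le ha (c := ∫ x, ‖x‖ ^ 2 ∂μ) fun s => ?_
    simp_rw [← hCv]
    exact sum_inner_covarianceOperator_le hμ hv s
  obtain ⟨lam, h0, hanti, hlam⟩ := exists_antitone_rearrangement a fun ε hε => by
    have := hsum.tendsto_cofinite_zero.eventually (gt_mem_nhds hε)
    simpa [Filter.eventually_cofinite] using this
  refine ⟨lam, h0, hanti, fun x hx => ?_⟩
  have := hfd x hx
  rcases lt_or_gt_of_ne hx with hneg | hpos
  · have hE : eigenspace (C : Module.End ℝ H) x = ⊥ := by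
      refine (Submodule.eq_bot_iff _).2 fun v hv => ?_
      by_contra hv0
      exact absurd (hnn x v hv hv0) (not_le.2 hneg)
    have hempty : {j : ℕ | lam j = x} = ∅ :=
      Set.eq_empty_of_forall_notMem fun j (hj : lam j = x) =>
        absurd (h0 j) (not_le.2 (hj ▸ hneg))
    rw [hE, hempty]
    simp
  · obtain ⟨hfin, hcard⟩ := hlam x hpos
    have hcard' : {i | a i = x}.ncard = Module.finrank ℝ (eigenspace (C : Module.End ℝ H) x) := by
      have hrange : {i | a i = x} = Set.range
          (fun k : Fin (Module.finrank ℝ (eigenspace (C : Module.End ℝ H) x)) =>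
            (⟨⟨x, hx⟩, k⟩ : ι)) := by
        ext ⟨⟨y, hy⟩, k⟩
        simp only [Set.mem_ofPred_eq, Set.mem_range, a]
        refine ⟨?_, ?_⟩
        · rintro rfl; exact ⟨k, rfl⟩
        · rintro ⟨k', h⟩
          exact (congrArg (fun i : ι => i.1.1) h).symm
      have hinj : Function.Injective
          (fun k : Fin (Module.finrank ℝ (eigenspace (C : Module.End ℝ H) x)) =>
            (⟨⟨x, hx⟩, k⟩ : ι)) := fun k k' h => eq_of_heq (Sigma.mk.inj h).2
      rw [hrange, ← Set.image_univ, Set.ncard_image_of_injective _ hinj,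
        Set.ncard_univ, Nat.card_fin]
    rw [← Module.finrank_eq_rank, ← hcard', ← hcard, ← Set.cast_ncard hfin, Cardinal.lift_natCast]

/-- The ordered eigenvalues of a covariance operator sum to its trace, the second moment. -/
theorem hasSum_eigenvalues_covarianceOperator {μ : Measure H} (hμ : MemLp id 2 μ) {lam : ℕ → ℝ}
    {e : ℕ → H} (hortho : ∀ i j, i ≠ j → ⟪e i, e j⟫_ℝ = 0) (hnorm : ∀ j, lam j ≠ 0 → ‖e j‖ = 1)
    (heig : ∀ j, covarianceOperator μ (e j) = lam j • e j)
    (hker : ∀ x, (∀ j, ⟪e j, x⟫_ℝ = 0) → covarianceOperator μ x = 0)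
    (hzero : ∀ j, lam j = 0 → e j = 0) :
    HasSum lam (∫ x, ‖x‖ ^ 2 ∂μ) := by
  set J := {j : ℕ // lam j ≠ 0}
  have hJ : Orthonormal ℝ (fun j : J => e j.1) :=
    ⟨fun j => hnorm _ j.2, fun i j hij => hortho _ _ fun h => hij (Subtype.ext h)⟩
  obtain ⟨w, b, hw, hb⟩ := hJ.toSubtypeRange.exists_hilbertBasis_extension
  have hcount : Countable w := b.orthonormal.countable_of_secondCountable
  have htr := hasSum_inner_covarianceOperator hμ b
  -- the basis vectors that are not among the `e j` do not contribute to the trace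
  let g : J → w := fun j => ⟨e j.1, hw ⟨j, rfl⟩⟩
  have hg : Function.Injective g := fun i j hij =>
    hJ.linearIndependent.injective (congrArg Subtype.val hij)
  have hbg (j : J) : b (g j) = e j.1 := by rw [hb]
  have h0 (i : w) (hi : i ∉ Set.range g) : ⟪covarianceOperator μ (b i), b i⟫_ℝ = 0 := by
    rw [hker (b i) fun j => ?_, inner_zero_left]
    by_cases hj : lam j = 0
    · rw [hzero j hj, inner_zero_left]
    · rw [← hbg ⟨j, hj⟩]
      exact b.orthonormal.2 fun h => hi ⟨_, h⟩
  have h1 := (hg.hasSum_iff h0).2 htr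
  have h2 : HasSum (fun j : J => lam j.1) (∫ x, ‖x‖ ^ 2 ∂μ) := by
    refine h1.congr_fun fun j => ?_
    simp only [Function.comp_apply]
    rw [hbg, heig, real_inner_smul_left, real_inner_self_eq_norm_sq, hnorm _ j.2]; simp
  exact (Subtype.val_injective.hasSum_iff fun j hj => by
    by_contra h
    exact hj ⟨⟨j, h⟩, rfl⟩).1 h2

end OrderedEigenvalues

/-! ### Weighted sums of independent chi-square variables -/

section ChiSquare

theorem ae_summable_of_summable_integral_norm {Ω : Type*} [MeasurableSpace Ω] {P : Measure Ω}
    {F : ℕ → Ω → ℝ} (hF : ∀ i, Integrable (F i) P) (hs : Summable fun i => ∫ ω, ‖F i ω‖ ∂P) :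
    ∀ᵐ ω ∂P, Summable fun i => F i ω := by
  have hfin : ∫⁻ ω, ∑' i, ‖F i ω‖ₑ ∂P ≠ ⊤ := by
    rw [lintegral_tsum fun i => (hF i).aestronglyMeasurable.enorm]
    simp_rw [fun i => (ofReal_integral_norm_eq_lintegral_enorm (hF i)).symm]
    exact hs.tsum_ofReal_ne_top
  filter_upwards [ae_lt_top' (AEMeasurable.tsum fun i =>
    (hF i).aestronglyMeasurable.enorm) hfin] with ω hω
  exact Summable.of_nnnorm (ENNReal.tsum_coe_ne_top_iff_summable.1 hω.ne)

theorem integrable_tsum_of_summable_integral_norm {Ω : Type*} [MeasurableSpace Ω] {P : Measure Ω}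
    {F : ℕ → Ω → ℝ} (hF : ∀ i, Integrable (F i) P) (hs : Summable fun i => ∫ ω, ‖F i ω‖ ∂P) :
    Integrable (fun ω => ∑' i, F i ω) P := by
  have hsum := ae_summable_of_summable_integral_norm hF hs
  have hmeas : AEMeasurable (fun ω => ∑' i, F i ω) P :=
    aemeasurable_of_tendsto_metrizable_ae atTop (f := fun n ω => ∑ i ∈ Finset.range n, F i ω)
      (fun n => Finset.aemeasurable_fun_sum _ fun i _ => (hF i).aemeasurable)
      (hsum.mono fun ω hω => hω.hasSum.tendsto_sum_nat)
  refine ⟨hmeas.aestronglyMeasurable, ?_⟩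
  calc ∫⁻ ω, ‖∑' i, F i ω‖ₑ ∂P ≤ ∫⁻ ω, ∑' i, ‖F i ω‖ₑ ∂P :=
        lintegral_mono fun ω => enorm_tsum_le_tsum_enorm
    _ = ∑' i, ENNReal.ofReal (∫ ω, ‖F i ω‖ ∂P) := by
        rw [lintegral_tsum fun i => (hF i).aestronglyMeasurable.enorm]
        simp_rw [fun i => (ofReal_integral_norm_eq_lintegral_enorm (hF i)).symm]
    _ < ⊤ := hs.tsum_ofReal_lt_top

instance isProbabilityMeasure_chiSquareOne : IsProbabilityMeasure chiSquareOne :=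
  Measure.isProbabilityMeasure_map (by fun_prop)

variable {Ω : Type*} [MeasurableSpace Ω] {P : Measure Ω}

theorem ProbabilityTheory.HasLaw.ae_nonneg_of_chiSquareOne {X : Ω → ℝ}
    (hX : HasLaw X chiSquareOne P) :
    ∀ᵐ ω ∂P, 0 ≤ X ω := by
  have h : ∀ᵐ x ∂(P.map X), 0 ≤ x := by
    rw [hX.map_eq, chiSquareOne, ae_map_iff (by fun_prop) measurableSet_Ici]
    exact ae_of_all _ fun x => sq_nonneg x
  exact ae_of_ae_map hX.aemeasurable h

theorem ProbabilityTheory.HasLaw.integrable_of_chiSquareOne {X : Ω → ℝ}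
    (hX : HasLaw X chiSquareOne P) :
    Integrable X P := by
  have h : Integrable id (P.map X) := by
    rw [hX.map_eq, chiSquareOne, integrable_map_measure (by fun_prop) (by fun_prop)]
    exact (memLp_id_gaussianReal' 2 (by simp)).integrable_sq
  exact (integrable_map_measure (by fun_prop) hX.aemeasurable).1 h

theorem ProbabilityTheory.HasLaw.integral_of_chiSquareOne {X : Ω → ℝ}
    (hX : HasLaw X chiSquareOne P) :
    ∫ ω, X ω ∂P = 1 := by
  rw [hX.integral_eq, chiSquareOne, integral_map (by fun_prop) (by fun_prop)]
  have := variance_of_integral_eq_zero (X := id) (μ := gaussianReal 0 1) (by fun_prop)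
    integral_id_gaussianReal
  rw [variance_id_gaussianReal] at this
  simpa using this.symm

variable {X : ℕ → Ω → ℝ} {lam : ℕ → ℝ}

theorem integral_norm_mul_chiSquare (hX : ∀ j, HasLaw (X j) chiSquareOne P)
    (h0 : ∀ j, 0 ≤ lam j) (j : ℕ) : ∫ ω, ‖lam j * X j ω‖ ∂P = lam j := by
  have h : (fun ω => ‖lam j * X j ω‖) =ᵐ[P] fun ω => lam j * X j ω := by
    filter_upwards [(hX j).ae_nonneg_of_chiSquareOne] with ω hω
    exact Real.norm_of_nonneg (mul_nonneg (h0 j) hω)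
  rw [integral_congr_ae h, integral_const_mul, (hX j).integral_of_chiSquareOne, mul_one]

theorem ae_summable_mul_chiSquare (hX : ∀ j, HasLaw (X j) chiSquareOne P)
    (h0 : ∀ j, 0 ≤ lam j) (hs : Summable lam) :
    ∀ᵐ ω ∂P, Summable fun j => lam j * X j ω :=
  ae_summable_of_summable_integral_norm
    (fun j => (hX j).integrable_of_chiSquareOne.const_mul (lam j))
    (by simpa only [integral_norm_mul_chiSquare hX h0] using hs)

theorem integrable_tsum_mul_chiSquare (hX : ∀ j, HasLaw (X j) chiSquareOne P)
    (h0 : ∀ j, 0 ≤ lam j) (hs : Summable lam) :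
    Integrable (fun ω => ∑' j, lam j * X j ω) P :=
  integrable_tsum_of_summable_integral_norm
    (fun j => (hX j).integrable_of_chiSquareOne.const_mul (lam j))
    (by simpa only [integral_norm_mul_chiSquare hX h0] using hs)

/-- The mean distance between the weighted chi-square series and its partial sums is the tail of
the series of weights. -/
theorem integral_abs_sum_sub_tsum_mul_chiSquare (hX : ∀ j, HasLaw (X j) chiSquareOne P)
    (h0 : ∀ j, 0 ≤ lam j) (hs : Summable lam) (k : ℕ) :
    ∫ ω, |∑ j ∈ Finset.range k, lam j * X j ω - ∑' j, lam j * X j ω| ∂P =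
      ∑' j, lam j - ∑ j ∈ Finset.range k, lam j := by
  have hi (j : ℕ) := (hX j).integrable_of_chiSquareOne.const_mul (lam j)
  have hpos : ∀ᵐ ω ∂P, ∀ j, 0 ≤ lam j * X j ω := ae_all_iff.2 fun j =>
    (hX j).ae_nonneg_of_chiSquareOne.mono fun ω hω => mul_nonneg (h0 j) hω
  have habs : (fun ω => |∑ j ∈ Finset.range k, lam j * X j ω - ∑' j, lam j * X j ω|) =ᵐ[P]
      fun ω => ∑' j, lam j * X j ω - ∑ j ∈ Finset.range k, lam j * X j ω := by
    filter_upwards [hpos, ae_summable_mul_chiSquare hX h0 hs] with ω hω hsω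
    rw [abs_sub_comm, abs_of_nonneg]
    exact sub_nonneg.2 (hsω.sum_le_tsum _ fun j _ => hω j)
  have htot : ∫ ω, ∑' j, lam j * X j ω ∂P = ∑' j, lam j := by
    rw [← integral_tsum_of_summable_integral_norm hi
      (by simpa only [integral_norm_mul_chiSquare hX h0] using hs)]
    simp_rw [integral_const_mul, fun j => (hX j).integral_of_chiSquareOne, mul_one]
  rw [integral_congr_ae habs, integral_sub (integrable_tsum_mul_chiSquare hX h0 hs)
    (integrable_finsetSum _ fun j _ => hi j), htot, integral_finsetSum _ fun j _ => hi j]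
  simp_rw [integral_const_mul, fun j => (hX j).integral_of_chiSquareOne, mul_one]

/-- For independent centred Gaussian coordinates with variances `lam j`, the sum of squares has
the law of the partial sum of the weighted chi-square series. -/
theorem map_sum_sq_pi_gaussianReal [IsProbabilityMeasure P]
    (hX : ∀ j, HasLaw (X j) chiSquareOne P)
    (h0 : ∀ j, 0 ≤ lam j) (hind : iIndepFun X P) (k : ℕ) :
    (Measure.pi fun j : Fin k => gaussianReal 0 (lam j).toNNReal).map (fun x => ∑ j, x j ^ 2) =
      P.map fun ω => ∑ j ∈ Finset.range k, lam j * X j ω := by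
  have hg (j : Fin k) : gaussianReal 0 (lam j).toNNReal =
      (gaussianReal 0 1).map (fun x => √(lam j) * x) := by
    rw [gaussianReal_map_const_mul]
    congr 1
    · simp
    · ext
      simp [Real.sq_sqrt (h0 j), h0 j]
  have h1 : P.map (fun ω (j : Fin k) => X j ω) = Measure.pi fun _ : Fin k => chiSquareOne := by
    have hk : iIndepFun (fun (j : Fin k) => X j) P := hind.precomp Fin.val_injective
    rw [iIndepFun.map_fun_eq_pi_map (fun j : Fin k => (hX j).aemeasurable) hk]
    simp_rw [fun j => (hX j).map_eq]
  have h2 : P.map (fun ω => ∑ j ∈ Finset.range k, lam j * X j ω) =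
      (P.map (fun ω (j : Fin k) => X j ω)).map (fun x => ∑ j : Fin k, lam j * x j) := by
    rw [AEMeasurable.map_map_of_aemeasurable
      (g := fun x : Fin k → ℝ => ∑ j : Fin k, lam j * x j) (f := fun ω (j : Fin k) => X j ω)
      (Finset.measurable_fun_sum _ fun j _ =>
        (measurable_pi_apply j).const_mul _).aemeasurable
      (aemeasurable_pi_lambda _ fun j => (hX j).aemeasurable)]
    congr 1
    funext ω
    simp [Finset.sum_range]
  rw [h2, h1]
  simp_rw [hg, chiSquareOne]
  rw [← Measure.pi_map_pi (fun j => by fun_prop), ← Measure.pi_map_pi (fun j => by fun_prop),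
    Measure.map_map (by fun_prop) (by fun_prop), Measure.map_map (by fun_prop) (by fun_prop)]
  congr 1
  funext x
  simp [mul_pow, Real.sq_sqrt (h0 _)]

end ChiSquare

/-! ### The central limit theorem for the squared norm in a Hilbert space -/

section CLT

open scoped InnerProductSpace

theorem norm_charFun_map_sub_le {Ω : Type*} [MeasurableSpace Ω] {P : Measure Ω}
    [IsProbabilityMeasure P] {A B : Ω → ℝ} (hA : AEMeasurable A P) (hB : AEMeasurable B P)
    (hAB : Integrable (fun ω => A ω - B ω) P) (t : ℝ) :
    ‖charFun (P.map A) t - charFun (P.map B) t‖ ≤ |t| * ∫ ω, |A ω - B ω| ∂P := by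
  have hint {D : Ω → ℝ} (hD : AEMeasurable D P) :
      Integrable (fun ω => Complex.exp (t * D ω * Complex.I)) P := by
    refine (integrable_const (1 : ℝ)).mono' (by fun_prop) (ae_of_all _ fun ω => ?_)
    rw [← Complex.ofReal_mul, Complex.norm_exp_ofReal_mul_I]
  rw [charFun_apply_real, charFun_apply_real, integral_map hA (by fun_prop),
    integral_map hB (by fun_prop), ← integral_sub (hint hA) (hint hB), ← integral_const_mul]
  refine norm_integral_le_of_norm_le (hAB.abs.const_mul |t|) (ae_of_all _ fun ω => ?_)
  have h : Complex.exp (t * A ω * Complex.I) - Complex.exp (t * B ω * Complex.I) =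
      Complex.exp ((t * B ω : ℝ) * Complex.I) *
        (Complex.exp (Complex.I * (t * (A ω - B ω) : ℝ)) - 1) := by
    rw [mul_sub, ← Complex.exp_add, mul_one]
    push_cast
    ring_nf
  rw [h, norm_mul, Complex.norm_exp_ofReal_mul_I, one_mul, ← abs_mul]
  exact Real.norm_exp_I_mul_ofReal_sub_one_le

variable {H : Type*} [NormedAddCommGroup H] [InnerProductSpace ℝ H]

theorem sum_sq_inner_le_norm_sq {lam : ℕ → ℝ} {e : ℕ → H}
    (hortho : ∀ i j, i ≠ j → ⟪e i, e j⟫_ℝ = 0) (hnorm : ∀ j, lam j ≠ 0 → ‖e j‖ = 1)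
    (hzero : ∀ j, lam j = 0 → e j = 0) (s : Finset ℕ) (x : H) :
    ∑ j ∈ s, ⟪e j, x⟫_ℝ ^ 2 ≤ ‖x‖ ^ 2 := by
  classical
  have hJ : Orthonormal ℝ (fun j : {j : ℕ // lam j ≠ 0} => e j.1) :=
    ⟨fun j => hnorm _ j.2, fun i j hij => hortho _ _ fun h => hij (Subtype.ext h)⟩
  have h := hJ.sum_inner_products_le x (s := s.subtype fun j => lam j ≠ 0)
  rw [Finset.sum_subtype_eq_sum_filter (f := fun j => ‖⟪e j, x⟫_ℝ‖ ^ 2),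
    Finset.sum_filter_of_ne] at h
  · simpa using h
  · intro j _ hj h0
    exact hj (by simp [hzero j h0])

/-- The normalized partial sum `n^{-1/2} (X₀ + ⋯ + X_{n-1})`. -/
noncomputable def normalizedSum {Ω : Type*} (X : ℕ → Ω → H) (n : ℕ) (ω : Ω) : H :=
  (√n)⁻¹ • ∑ i ∈ Finset.range n, X i ω

theorem inner_normalizedSum {Ω : Type*} (X : ℕ → Ω → H) (n : ℕ) (ω : Ω) (v : H) :
    ⟪v, normalizedSum X n ω⟫_ℝ = (√n)⁻¹ * ∑ i ∈ Finset.range n, ⟪v, X i ω⟫_ℝ := by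
  rw [normalizedSum, real_inner_smul_right, inner_sum]

variable [SecondCountableTopology H] [MeasurableSpace H] [BorelSpace H]
  {Ω : Type*} [MeasurableSpace Ω] {P : Measure Ω}
  {μ : Measure H} {X : ℕ → Ω → H}

theorem memLp_normalizedSum (hμ : MemLp id 2 μ) (hX : ∀ i, HasLaw (X i) μ P) (n : ℕ) :
    MemLp (normalizedSum X n) 2 P := by
  have hXi (i : ℕ) : MemLp (X i) 2 P := by
    have h := (hX i).map_eq ▸ hμ
    exact (memLp_map_measure_iff (by fun_prop) (hX i).aemeasurable).1 h
  exact (memLp_finsetSum (Finset.range n) fun i _ => hXi i).const_smul _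

theorem ProbabilityTheory.HasLaw.memLp_inner (hμ : MemLp id 2 μ)
    {Y : Ω → H} (hY : HasLaw Y μ P) (v : H) :
    MemLp (fun ω => ⟪v, Y ω⟫_ℝ) 2 P := by
  have h := hY.map_eq ▸ hμ
  exact ((memLp_map_measure_iff (by fun_prop) hY.aemeasurable).1 h).const_inner v

theorem integrable_norm_sq_sub_sum (hμ : MemLp id 2 μ) (hX : ∀ i, HasLaw (X i) μ P) (n : ℕ)
    (e : ℕ → H) (s : Finset ℕ) :
    Integrable (fun ω => ‖normalizedSum X n ω‖ ^ 2 -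
      ∑ j ∈ s, ⟪e j, normalizedSum X n ω⟫_ℝ ^ 2) P := by
  have hS := memLp_normalizedSum hμ hX n
  exact (hS.integrable_norm_pow two_ne_zero).sub
    (integrable_finsetSum _ fun j _ => (hS.const_inner (e j)).integrable_sq)

variable [CompleteSpace H] [IsProbabilityMeasure P]

theorem ProbabilityTheory.HasLaw.integral_inner_eq_zero (hμ : MemLp id 2 μ)
    (hmean : ∫ x, x ∂μ = 0) {Y : Ω → H}
    (hY : HasLaw Y μ P) (v : H) : ∫ ω, ⟪v, Y ω⟫_ℝ ∂P = 0 := by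
  have : IsProbabilityMeasure μ := hY.map_eq ▸ Measure.isProbabilityMeasure_map hY.aemeasurable
  have h := hY.integral_comp (f := fun x => ⟪v, x⟫_ℝ) (by fun_prop)
  simp only [Function.comp_def] at h
  rw [h, integral_inner (f := fun x : H => x) (hμ.integrable one_le_two) v, hmean,
    inner_zero_right]

theorem ProbabilityTheory.HasLaw.variance_inner (hμ : MemLp id 2 μ)
    (hmean : ∫ x, x ∂μ = 0) {Y : Ω → H}
    (hY : HasLaw Y μ P) (v : H) :
    Var[fun ω => ⟪v, Y ω⟫_ℝ; P] = ⟪covarianceOperator μ v, v⟫_ℝ := by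
  rw [variance_of_integral_eq_zero (hY.memLp_inner hμ v).aemeasurable
    (hY.integral_inner_eq_zero hμ hmean v), inner_covarianceOperator_self hμ]
  exact hY.integral_comp (f := fun x => ⟪v, x⟫_ℝ ^ 2) (by fun_prop)

/-- The normalized sums of independent centred vectors have the covariance of a single summand. -/
theorem integral_inner_normalizedSum_sq (hμ : MemLp id 2 μ) (hmean : ∫ x, x ∂μ = 0)
    (hX : ∀ i, HasLaw (X i) μ P) (hind : iIndepFun X P) {n : ℕ} (hn : n ≠ 0) (v : H) :
    ∫ ω, ⟪v, normalizedSum X n ω⟫_ℝ ^ 2 ∂P = ⟪covarianceOperator μ v, v⟫_ℝ := by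
  have hsum : Var[∑ i ∈ Finset.range n, (fun ω => ⟪v, X i ω⟫_ℝ); P] =
      n * ⟪covarianceOperator μ v, v⟫_ℝ := by
    rw [IndepFun.variance_sum (fun i _ => (hX i).memLp_inner hμ v) fun i _ j _ hij =>
      (hind.indepFun hij).comp (φ := fun x => ⟪v, x⟫_ℝ) (ψ := fun x => ⟪v, x⟫_ℝ)
        (by fun_prop) (by fun_prop)]
    simp_rw [(hX _).variance_inner hμ hmean v]
    simp
  have hmem : MemLp (∑ i ∈ Finset.range n, (fun ω => ⟪v, X i ω⟫_ℝ)) 2 P :=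
    memLp_finsetSum' _ fun i _ => (hX i).memLp_inner hμ v
  rw [variance_of_integral_eq_zero hmem.aemeasurable] at hsum
  · simp_rw [inner_normalizedSum, mul_pow, integral_const_mul, inv_pow,
      Real.sq_sqrt (Nat.cast_nonneg n)]
    simp only [Finset.sum_apply] at hsum
    rw [hsum]
    field_simp
  · simp only [Finset.sum_apply]
    rw [integral_finsetSum _ fun i _ => ((hX i).memLp_inner hμ v).integrable one_le_two]
    exact Finset.sum_eq_zero fun i _ => (hX i).integral_inner_eq_zero hμ hmean v

theorem integral_norm_normalizedSum_sq (hμ : MemLp id 2 μ) (hmean : ∫ x, x ∂μ = 0)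
    (hX : ∀ i, HasLaw (X i) μ P) (hind : iIndepFun X P) {n : ℕ} (hn : n ≠ 0) :
    ∫ ω, ‖normalizedSum X n ω‖ ^ 2 ∂P = ∫ x, ‖x‖ ^ 2 ∂μ := by
  have hS := memLp_normalizedSum hμ hX n
  have hν : MemLp id 2 (P.map (normalizedSum X n)) :=
    (memLp_map_measure_iff (by fun_prop) hS.aemeasurable).2 hS
  obtain ⟨w, b, -⟩ := exists_hilbertBasis ℝ H
  have hcount : Countable w := b.orthonormal.countable_of_secondCountable
  have h1 := hasSum_inner_covarianceOperator hν b
  rw [integral_map hS.aemeasurable (by fun_prop)] at h1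
  refine h1.unique ((hasSum_inner_covarianceOperator hμ b).congr_fun fun i => ?_)
  rw [inner_covarianceOperator_self hν, integral_map hS.aemeasurable (by fun_prop),
    integral_inner_normalizedSum_sq hμ hmean hX hind hn]

/-- Mean distance between the squared norm of a normalized sum and the sum of its squared
coordinates along finitely many orthogonal directions. -/
theorem integral_abs_norm_sq_sub_sum (hμ : MemLp id 2 μ) (hmean : ∫ x, x ∂μ = 0)
    (hX : ∀ i, HasLaw (X i) μ P) (hind : iIndepFun X P) {n : ℕ} (hn : n ≠ 0) {e : ℕ → H}
    {s : Finset ℕ} (hbessel : ∀ x, ∑ j ∈ s, ⟪e j, x⟫_ℝ ^ 2 ≤ ‖x‖ ^ 2) :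
    ∫ ω, |‖normalizedSum X n ω‖ ^ 2 - ∑ j ∈ s, ⟪e j, normalizedSum X n ω⟫_ℝ ^ 2| ∂P =
      ∫ x, ‖x‖ ^ 2 ∂μ - ∑ j ∈ s, ⟪covarianceOperator μ (e j), e j⟫_ℝ := by
  have hS := memLp_normalizedSum hμ hX n
  have hi (j : ℕ) : Integrable (fun ω => ⟪e j, normalizedSum X n ω⟫_ℝ ^ 2) P :=
    (hS.const_inner (e j)).integrable_sq
  simp_rw [fun ω => abs_of_nonneg (sub_nonneg.2 (hbessel (normalizedSum X n ω)))]
  rw [integral_sub (hS.integrable_norm_pow two_ne_zero) (integrable_finsetSum _ fun j _ => hi j),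
    integral_finsetSum _ fun j _ => hi j, integral_norm_normalizedSum_sq hμ hmean hX hind hn]
  simp_rw [integral_inner_normalizedSum_sq hμ hmean hX hind hn]

theorem tendsto_charFun_inner_normalizedSum (hμ : MemLp id 2 μ) (hmean : ∫ x, x ∂μ = 0)
    (hX : ∀ i, HasLaw (X i) μ P) (hind : iIndepFun X P) (v : H) :
    Tendsto (fun n => charFun (P.map fun ω => ⟪v, normalizedSum X n ω⟫_ℝ) 1) atTop
      (𝓝 (Complex.exp (-(⟪covarianceOperator μ v, v⟫_ℝ : ℂ) / 2))) := by
  have hclt := tendstoInDistribution_inv_sqrt_mul_sum_sub (P := P) (X := fun i ω => ⟪v, X i ω⟫_ℝ)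
    (HasLaw.id (μ := gaussianReal 0 Var[fun ω => ⟪v, X 0 ω⟫_ℝ; P].toNNReal))
    ((hX 0).memLp_inner hμ v)
    (hind.comp (fun _ x => ⟪v, x⟫_ℝ) fun _ => by fun_prop)
    fun i => ((hX i).identDistrib (hX 0)).comp (u := fun x => ⟪v, x⟫_ℝ) (by fun_prop)
  have h := ProbabilityMeasure.tendsto_iff_tendsto_charFun.1 hclt.tendsto 1
  have hnn : 0 ≤ ⟪covarianceOperator μ v, v⟫_ℝ := by
    rw [inner_covarianceOperator_self hμ]; exact integral_nonneg fun _ => sq_nonneg _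
  simp only [ProbabilityMeasure.coe_mk, (hX 0).integral_inner_eq_zero hμ hmean v,
    (hX 0).variance_inner hμ hmean v, Measure.map_id, charFun_gaussianReal,
    Real.coe_toNNReal _ hnn] at h
  convert h using 2
  · simp [inner_normalizedSum]
  · congr 1
    simp
    ring

/-- Finitely many eigen-coordinates of the normalized sums are asymptotically independent centred
Gaussian variables, with the eigenvalues as variances; this is expressed through the
characteristic function of the sum of their squares. -/
theorem tendsto_charFun_sum_sq_inner {Ω' : Type*} [MeasurableSpace Ω'] {P' : Measure Ω'}
    [IsProbabilityMeasure P'] (hμ : MemLp id 2 μ) (hmean : ∫ x, x ∂μ = 0)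
    (hX : ∀ i, HasLaw (X i) μ P) (hind : iIndepFun X P)
    {lam : ℕ → ℝ} (h0 : ∀ j, 0 ≤ lam j) {e : ℕ → H}
    (hortho : ∀ i j, i ≠ j → ⟪e i, e j⟫_ℝ = 0) (hnorm : ∀ j, lam j ≠ 0 → ‖e j‖ = 1)
    (heig : ∀ j, covarianceOperator μ (e j) = lam j • e j)
    {χ : ℕ → Ω' → ℝ} (hχ : iIndepFun χ P') (hχlaw : ∀ j, HasLaw (χ j) chiSquareOne P')
    (k : ℕ) (t : ℝ) :
    Tendsto (fun n => charFun
        (P.map fun ω => ∑ j ∈ Finset.range k, ⟪e j, normalizedSum X n ω⟫_ℝ ^ 2) t) atTop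
      (𝓝 (charFun (P'.map fun ω => ∑ j ∈ Finset.range k, lam j * χ j ω) t)) := by
  let V : ℕ → Ω → EuclideanSpace ℝ (Fin k) := fun n ω =>
    WithLp.toLp 2 fun j => ⟪e j, normalizedSum X n ω⟫_ℝ
  let Q : Measure (EuclideanSpace ℝ (Fin k)) :=
    (Measure.pi fun j : Fin k => gaussianReal 0 (lam j).toNNReal).map (WithLp.toLp 2)
  have hQ : IsProbabilityMeasure Q := Measure.isProbabilityMeasure_map (by fun_prop)
  have hVm (n : ℕ) : AEMeasurable (V n) P := by
    have := (memLp_normalizedSum hμ hX n).aemeasurable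
    fun_prop
  have hquad (s : EuclideanSpace ℝ (Fin k)) :
      ⟪covarianceOperator μ (∑ j : Fin k, s j • e j), ∑ j : Fin k, s j • e j⟫_ℝ =
        ∑ j : Fin k, lam j * s j ^ 2 := by
    rw [map_sum, sum_inner]
    refine Finset.sum_congr rfl fun j _ => ?_
    rw [map_smul, heig, inner_sum, Finset.sum_eq_single j]
    · rw [real_inner_smul_left, real_inner_smul_left, real_inner_smul_right,
        real_inner_self_eq_norm_sq]
      by_cases hj : lam j = 0
      · simp [hj]
      · rw [hnorm _ hj]; ring
    · intro i _ hij
      rw [real_inner_smul_left, real_inner_smul_left, real_inner_smul_right,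
        hortho _ _ fun h => hij (Fin.ext h).symm]
      simp
    · simp
  have hV : TendstoInDistribution V atTop id (fun _ => P) Q := by
    refine ⟨hVm, aemeasurable_id, ProbabilityMeasure.tendsto_iff_tendsto_charFun.2 fun s => ?_⟩
    have h1 := tendsto_charFun_inner_normalizedSum hμ hmean hX hind (∑ j : Fin k, s j • e j)
    rw [hquad] at h1
    have hL (n : ℕ) : charFun (P.map (V n)) s =
        charFun (P.map fun ω => ⟪∑ j : Fin k, s j • e j, normalizedSum X n ω⟫_ℝ) 1 := by
      have := (memLp_normalizedSum hμ hX n).aemeasurable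
      rw [charFun_apply, charFun_apply, integral_map (hVm n) (by fun_prop),
        integral_map (by fun_prop) (by fun_prop)]
      refine integral_congr_ae (ae_of_all _ fun ω => ?_)
      simp [V, PiLp.inner_apply, sum_inner, real_inner_smul_left]
    have hR : charFun Q s = Complex.exp (-((∑ j : Fin k, lam j * s j ^ 2 : ℝ) : ℂ) / 2) := by
      simp only [Q]
      rw [charFun_pi]
      simp_rw [charFun_gaussianReal, Real.coe_toNNReal _ (h0 _)]
      rw [← Complex.exp_sum]
      congr 1
      push_cast
      rw [← Finset.sum_neg_distrib, Finset.sum_div]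
      refine Finset.sum_congr rfl fun j _ => ?_
      simp
      ring
    simp only [ProbabilityMeasure.coe_mk, Measure.map_id, hL, hR]
    exact h1
  have h2 := (hV.continuous_comp (g := fun x => ∑ j, x j ^ 2) (by fun_prop)).tendsto
  have h3 := ProbabilityMeasure.tendsto_iff_tendsto_charFun.1 h2 t
  have hlaw : Q.map ((fun x : EuclideanSpace ℝ (Fin k) => ∑ j, x j ^ 2) ∘ id) =
      P'.map fun ω => ∑ j ∈ Finset.range k, lam j * χ j ω := by
    rw [← map_sum_sq_pi_gaussianReal hχlaw h0 hχ k, Function.comp_id,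
      Measure.map_map (by fun_prop) (by fun_prop)]
    rfl
  simp only [ProbabilityMeasure.coe_mk, hlaw] at h3
  refine h3.congr fun n => ?_
  congr 2
  funext ω
  simp [V, Finset.sum_range]

/-- **Central limit theorem for the squared norm.** For independent centred copies of a
square-integrable random vector of a separable Hilbert space, the squared norm of the normalized
sums converges in distribution to the chi-square series weighted by the eigenvalues of the
covariance operator. -/
theorem tendstoInDistribution_norm_sq_normalizedSum {Ω' : Type*} [MeasurableSpace Ω']
    {P' : Measure Ω'} [IsProbabilityMeasure P'] [IsProbabilityMeasure μ]
    (hμ : MemLp id 2 μ) (hmean : ∫ x, x ∂μ = 0)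
    (hX : ∀ i, HasLaw (X i) μ P) (hind : iIndepFun X P)
    {lam : ℕ → ℝ} (h0 : ∀ j, 0 ≤ lam j)
    (hmult : ∀ x : ℝ, x ≠ 0 → Cardinal.lift (Cardinal.mk {j : ℕ | lam j = x}) =
      Module.rank ℝ (Module.End.eigenspace (covarianceOperator μ : Module.End ℝ H) x))
    {χ : ℕ → Ω' → ℝ} (hχ : iIndepFun χ P') (hχlaw : ∀ j, HasLaw (χ j) chiSquareOne P') :
    Summable lam ∧ TendstoInDistribution (fun n ω => ‖normalizedSum X n ω‖ ^ 2) atTop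
      (fun ω => ∑' j, lam j * χ j ω) (fun _ => P) P' := by
  obtain ⟨e, hortho, hnorm, hzero, heig, hker⟩ := exists_orthogonal_eigenvectors
    (isCompactOperator_covarianceOperator hμ) (isSymmetric_covarianceOperator μ) hmult
  have htr := hasSum_eigenvalues_covarianceOperator hμ hortho hnorm heig hker hzero
  have hS (n : ℕ) := memLp_normalizedSum hμ hX n
  have hSm (n : ℕ) := (hS n).aemeasurable
  have hAm (n : ℕ) : AEMeasurable (fun ω => ‖normalizedSum X n ω‖ ^ 2) P := by
    have := hSm n; fun_prop
  have hsm (k : ℕ) : AEMeasurable (fun ω => ∑ j ∈ Finset.range k, lam j * χ j ω) P' :=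
    Finset.aemeasurable_fun_sum _ fun j _ => (hχlaw j).aemeasurable.const_mul _
  have hlim := integrable_tsum_mul_chiSquare hχlaw h0 htr.summable
  refine ⟨htr.summable, hAm, hlim.aemeasurable,
    ProbabilityMeasure.tendsto_iff_tendsto_charFun.2 fun t => ?_⟩
  simp only [ProbabilityMeasure.coe_mk]
  have hCe (j : ℕ) : ⟪covarianceOperator μ (e j), e j⟫_ℝ = lam j := by
    rw [heig, real_inner_smul_left, real_inner_self_eq_norm_sq]
    by_cases hj : lam j = 0
    · simp [hj]
    · rw [hnorm _ hj]; ring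
  -- replace all three quantities by their first `k` coordinates, up to the tail of the trace
  have htail : Tendsto (fun k => |t| * (∑' j, lam j - ∑ j ∈ Finset.range k, lam j)) atTop
      (𝓝 0) := by
    have := (htr.summable.hasSum.tendsto_sum_nat.const_sub (∑' j, lam j)).const_mul |t|
    simpa using this
  rw [Metric.tendsto_atTop]
  intro ε hε
  obtain ⟨k, hk⟩ := (htail.eventually (gt_mem_nhds (show 0 < ε / 3 by positivity))).exists
  obtain ⟨N, hN⟩ := Metric.tendsto_atTop.1 (tendsto_charFun_sum_sq_inner hμ hmean hX hind h0
    hortho hnorm heig hχ hχlaw k t) (ε / 3) (by positivity)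
  refine ⟨max N 1, fun n hn => ?_⟩
  have hn0 : n ≠ 0 := by have := le_trans (le_max_right N 1) hn; omega
  have h1 := norm_charFun_map_sub_le (hAm n)
    (show AEMeasurable (fun ω => ∑ j ∈ Finset.range k, ⟪e j, normalizedSum X n ω⟫_ℝ ^ 2) P by
      have := hSm n; fun_prop) (integrable_norm_sq_sub_sum hμ hX n e _) t
  rw [integral_abs_norm_sq_sub_sum hμ hmean hX hind hn0
    (sum_sq_inner_le_norm_sq hortho hnorm hzero _), ← htr.tsum_eq] at h1
  simp_rw [hCe] at h1
  have h2 := hN n (le_trans (le_max_left N 1) hn)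
  have h3 := norm_charFun_map_sub_le (hsm k) hlim.aemeasurable
    ((integrable_finsetSum _ fun j _ =>
      (hχlaw j).integrable_of_chiSquareOne.const_mul (lam j)).sub hlim) t
  rw [integral_abs_sum_sub_tsum_mul_chiSquare hχlaw h0 htr.summable] at h3
  rw [dist_eq_norm] at h2 ⊢
  refine (norm_sub_le_norm_sub_add_norm_sub _ (charFun (P.map fun ω =>
    ∑ j ∈ Finset.range k, ⟪e j, normalizedSum X n ω⟫_ℝ ^ 2) t) _).trans_lt ?_
  have h4 := norm_sub_le_norm_sub_add_norm_sub (charFun (P.map fun ω =>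
    ∑ j ∈ Finset.range k, ⟪e j, normalizedSum X n ω⟫_ℝ ^ 2) t) (charFun (P'.map fun ω =>
    ∑ j ∈ Finset.range k, lam j * χ j ω) t) (charFun (P'.map fun ω => ∑' j, lam j * χ j ω) t)
  linarith

end CLT

/-! ### Random sequences as random vectors of `ℓ²` -/

section SequenceSpace

open scoped InnerProductSpace

theorem HilbertBasis.secondCountableTopology {ι H : Type*} [Countable ι] [NormedAddCommGroup H]
    [InnerProductSpace ℝ H] (b : HilbertBasis ι ℝ H) : SecondCountableTopology H := by
  have h : TopologicalSpace.IsSeparable (Set.univ : Set H) := by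
    have h1 := ((Set.countable_range b).isSeparable.span (R := ℝ)).closure
    rwa [← Submodule.topologicalClosure_coe, b.dense_span, Submodule.top_coe] at h1
  have := TopologicalSpace.isSeparable_univ_iff.1 h
  exact UniformSpace.secondCountable_of_separable H

/-- The standard Hilbert basis of `ℓ²`. -/
noncomputable def stdBasisL2 : HilbertBasis ℕ ℝ (lp (fun _ : ℕ => ℝ) 2) :=
  HilbertBasis.ofRepr (LinearIsometryEquiv.refl ℝ _)

theorem inner_stdBasisL2 (j : ℕ) (v : lp (fun _ : ℕ => ℝ) 2) : ⟪stdBasisL2 j, v⟫_ℝ = v j := by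
  rw [← HilbertBasis.repr_apply_apply]
  rfl

/-- `ℓ²` carries its Borel `σ`-algebra. -/
noncomputable instance measurableSpace_l2 : MeasurableSpace (lp (fun _ : ℕ => ℝ) 2) := borel _

instance secondCountableTopology_l2 : SecondCountableTopology (lp (fun _ : ℕ => ℝ) 2) :=
  stdBasisL2.secondCountableTopology

instance borelSpace_l2 : BorelSpace (lp (fun _ : ℕ => ℝ) 2) := ⟨rfl⟩

theorem memℓp_two_iff_summable_sq (a : ℕ → ℝ) : Memℓp a 2 ↔ Summable fun j => a j ^ 2 := by
  rw [memℓp_gen_iff (by norm_num)]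
  simp

theorem measurableSet_memℓp_two : MeasurableSet {a : ℕ → ℝ | Memℓp a 2} := by
  have h : {a : ℕ → ℝ | Memℓp a 2} = {a | ∑' j, ENNReal.ofReal (a j ^ 2) ≠ ⊤} := by
    ext a
    simp only [Set.mem_ofPred_eq, memℓp_two_iff_summable_sq]
    refine ⟨fun h => h.tsum_ofReal_ne_top, fun h => ?_⟩
    have := ENNReal.summable_toReal h
    simpa [ENNReal.toReal_ofReal, sq_nonneg] using this
  rw [h]
  have hm : Measurable fun a : ℕ → ℝ => ∑' j, ENNReal.ofReal (a j ^ 2) :=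
    Measurable.tsum fun j => by fun_prop
  exact hm (measurableSet_singleton _).compl

open Classical in
/-- A real sequence as an element of `ℓ²`; sequences that are not square summable are sent to
zero. -/
noncomputable def seqToL2 (a : ℕ → ℝ) : lp (fun _ : ℕ => ℝ) 2 :=
  if h : Memℓp a 2 then ⟨a, h⟩ else 0

theorem seqToL2_apply {a : ℕ → ℝ} (h : Memℓp a 2) (j : ℕ) : seqToL2 a j = a j := by
  rw [seqToL2, dif_pos h]

theorem measurable_seqToL2 : Measurable seqToL2 := by
  have hc (j : ℕ) : Measurable fun a : ℕ → ℝ => Set.indicator {a | Memℓp a 2} (fun a => a j) a :=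
    (measurable_pi_apply j).indicator measurableSet_memℓp_two
  refine measurable_of_tendsto_metrizable
    (f := fun n a => ∑ j ∈ Finset.range n,
      Set.indicator {a : ℕ → ℝ | Memℓp a 2} (fun a => a j) a • stdBasisL2 j)
    (fun n => Finset.measurable_fun_sum _ fun j _ => (hc j).smul_const _) ?_
  rw [tendsto_pi_nhds]
  intro a
  by_cases h : Memℓp a 2
  · have hs := (stdBasisL2.hasSum_repr (seqToL2 a)).tendsto_sum_nat
    refine hs.congr fun n => Finset.sum_congr rfl fun j _ => ?_
    rw [HilbertBasis.repr_apply_apply, inner_stdBasisL2, seqToL2_apply h,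
      Set.indicator_of_mem (show a ∈ {a : ℕ → ℝ | Memℓp a 2} from h)]
  · have h0 : seqToL2 a = 0 := by rw [seqToL2, dif_neg h]
    rw [h0]
    refine tendsto_const_nhds.congr fun n => ?_
    refine (Finset.sum_eq_zero fun j _ => ?_).symm
    rw [Set.indicator_of_notMem (show a ∉ {a : ℕ → ℝ | Memℓp a 2} from h), zero_smul]

variable {Ω : Type*} [MeasurableSpace Ω] {P : Measure Ω} {ξ : ℕ → Ω → ℝ}

theorem ae_memℓp_of_summable_integral_sq (hξ : ∀ j, Integrable (fun ω => ξ j ω ^ 2) P)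
    (hs : Summable fun j => ∫ ω, ξ j ω ^ 2 ∂P) : ∀ᵐ ω ∂P, Memℓp (fun j => ξ j ω) 2 := by
  simp_rw [memℓp_two_iff_summable_sq]
  exact ae_summable_of_summable_integral_norm hξ (by simpa using hs)

theorem memLp_seqToL2 (hm : ∀ j, Measurable (ξ j)) (hξ : ∀ j, Integrable (fun ω => ξ j ω ^ 2) P)
    (hs : Summable fun j => ∫ ω, ξ j ω ^ 2 ∂P) : MemLp (fun ω => seqToL2 fun j => ξ j ω) 2 P := by
  have hmeas : Measurable (fun ω => seqToL2 fun j => ξ j ω) :=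
    measurable_seqToL2.comp (measurable_pi_lambda _ hm)
  rw [memLp_two_iff_integrable_sq_norm hmeas.aestronglyMeasurable]
  refine (integrable_tsum_of_summable_integral_norm hξ (by simpa using hs)).congr ?_
  filter_upwards [ae_memℓp_of_summable_integral_sq hξ hs] with ω hω
  rw [← real_inner_self_eq_norm_sq, lp.inner_eq_tsum]
  simp [seqToL2_apply hω, pow_two]

theorem integral_map_seqToL2 [IsProbabilityMeasure P] (hm : ∀ j, Measurable (ξ j))
    (hξ : ∀ j, Integrable (fun ω => ξ j ω ^ 2) P) (hs : Summable fun j => ∫ ω, ξ j ω ^ 2 ∂P)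
    (hmean : ∀ j, ∫ ω, ξ j ω ∂P = 0) :
    ∫ x, x ∂(P.map fun ω => seqToL2 fun j => ξ j ω) = 0 := by
  have hL := memLp_seqToL2 hm hξ hs
  rw [integral_map hL.aemeasurable (by fun_prop)]
  ext j
  rw [← inner_stdBasisL2, ← integral_inner (hL.integrable one_le_two), lp.coeFn_zero,
    Pi.zero_apply, ← hmean j]
  refine integral_congr_ae ?_
  filter_upwards [ae_memℓp_of_summable_integral_sq hξ hs] with ω hω
  rw [inner_stdBasisL2, seqToL2_apply hω]

theorem inner_covarianceOperator_map_seqToL2 (hm : ∀ j, Measurable (ξ j))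
    (hξ : ∀ j, Integrable (fun ω => ξ j ω ^ 2) P) (hs : Summable fun j => ∫ ω, ξ j ω ^ 2 ∂P)
    (hmean : ∀ j, ∫ ω, ξ j ω ∂P = 0) (j l : ℕ) :
    ⟪covarianceOperator (P.map fun ω => seqToL2 fun j => ξ j ω) (stdBasisL2 j), stdBasisL2 l⟫_ℝ =
      cov[ξ j, ξ l; P] := by
  have hL := memLp_seqToL2 hm hξ hs
  have hν : MemLp id 2 (P.map fun ω => seqToL2 fun j => ξ j ω) :=
    (memLp_map_measure_iff (by fun_prop) hL.aemeasurable).2 hL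
  rw [covarianceOperator_inner hν, integral_map hL.aemeasurable (by fun_prop), covariance,
    hmean j, hmean l]
  refine integral_congr_ae ?_
  filter_upwards [ae_memℓp_of_summable_integral_sq hξ hs] with ω hω
  simp [inner_stdBasisL2, seqToL2_apply hω]

/-- The eigenspaces of an infinite matrix that represents a symmetric bounded operator of `ℓ²` are
those of the operator. -/
theorem matrixEigenspace_eq_eigenspace
    {T : lp (fun _ : ℕ => ℝ) 2 →L[ℝ] lp (fun _ : ℕ => ℝ) 2}
    (hT : (T : lp (fun _ : ℕ => ℝ) 2 →ₗ[ℝ] lp (fun _ : ℕ => ℝ) 2).IsSymmetric)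
    {S : Matrix ℕ ℕ ℝ} (hS : ∀ j l, ⟪T (stdBasisL2 j), stdBasisL2 l⟫_ℝ = S j l) (x : ℝ) :
    matrixEigenspace S x =
      Module.End.eigenspace (T : Module.End ℝ (lp (fun _ : ℕ => ℝ) 2)) x := by
  ext v
  have hrow (j : ℕ) : HasSum (fun l => S j l * v l) (T v j) := by
    have h := lp.hasSum_inner (𝕜 := ℝ) (T (stdBasisL2 j)) v
    rw [show ⟪T (stdBasisL2 j), v⟫_ℝ = ⟪stdBasisL2 j, T v⟫_ℝ from hT _ _, inner_stdBasisL2] at h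
    refine h.congr_fun fun l => ?_
    rw [← hS, real_inner_comm, inner_stdBasisL2]
    simp [mul_comm]
  rw [Module.End.mem_eigenspace_iff]
  refine ⟨fun h => ?_, fun h j => ?_⟩
  · ext j
    exact (hrow j).unique (h j)
  · have h' : T v = x • v := h
    have := hrow j
    rwa [h'] at this

end SequenceSpace

/-! ### The vectors `(U f_j^τ(W))_j` and the test statistic -/

section Application

open scoped InnerProductSpace

theorem summable_weights {τ : ℕ → ℝ} (hτ0 : ∀ j, 0 ≤ τ j) {m : ℕ → ℕ}
    (hτ : (fun n => ∑ j ∈ Finset.range (m n), τ j) =O[atTop] (fun _ => (1 : ℝ)))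
    (hm : Tendsto m atTop atTop) : Summable τ := by
  obtain ⟨c, hc⟩ := hτ.bound
  refine summable_of_sum_range_le hτ0 (c := c) fun k => ?_
  obtain ⟨n, hn, hk⟩ := (hc.and (hm.eventually_ge_atTop k)).exists
  calc ∑ j ∈ Finset.range k, τ j ≤ ∑ j ∈ Finset.range (m n), τ j :=
        Finset.sum_le_sum_of_subset_of_nonneg (Finset.range_mono hk) fun j _ _ => hτ0 j
    _ ≤ c := by simpa using (le_abs_self _).trans hn

variable {Ω : Type*} [MeasurableSpace Ω] {P : Measure Ω} {d : ℕ}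
  {W : Ω → EuclideanSpace ℝ (Fin d)} {pW ν : EuclideanSpace ℝ (Fin d) → ℝ}

theorem map_le_smul_densityMeasure (hpW : IsDensityOf pW W P) (hν : Measurable ν) {c : ℝ}
    (hc : 0 ≤ c) (hpos : ∀ w ∈ rvSupport P W, 0 < ν w ∧ pW w / ν w ≤ c) :
    P.map W ≤ ENNReal.ofReal c • densityMeasure ν := by
  refine Measure.le_iff.2 fun A hA => ?_
  have hS : MeasurableSet (rvSupport P W) := Measure.isClosed_support.measurableSet
  have hAS : P.map W A = P.map W (A ∩ rvSupport P W) :=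
    (measure_inter_conull (show P.map W (rvSupport P W)ᶜ = 0 from Measure.support_mem_ae)).symm
  calc P.map W A = ∫⁻ w in A ∩ rvSupport P W, ENNReal.ofReal (pW w) := by
        rw [hAS, hpW.map_eq, densityMeasure, withDensity_apply _ (hA.inter hS)]
    _ ≤ ∫⁻ w in A ∩ rvSupport P W, ENNReal.ofReal c * ENNReal.ofReal (ν w) := by
        refine setLIntegral_mono (by fun_prop) fun w hw => ?_
        obtain ⟨h1, h2⟩ := hpos w hw.2
        rw [← ENNReal.ofReal_mul hc]
        exact ENNReal.ofReal_le_ofReal ((div_le_iff₀ h1).1 h2)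
    _ ≤ ∫⁻ w in A, ENNReal.ofReal c * ENNReal.ofReal (ν w) :=
        lintegral_mono_set Set.inter_subset_left
    _ = (ENNReal.ofReal c • densityMeasure ν) A := by
        rw [lintegral_const_mul _ (by fun_prop), Measure.smul_apply, densityMeasure,
          withDensity_apply _ hA, smul_eq_mul]

/-- The domination condition on the density of `W` transfers the fourth moment bound from `L⁴_ν`
to the law of `W`. -/
theorem integral_pow_four_comp_le (hW : Measurable W) (hpW : IsDensityOf pW W P)
    (hν : IsProbDensity ν) {c K : ℝ} (hc : 0 ≤ c)
    (hpos : ∀ w ∈ rvSupport P W, 0 < ν w ∧ pW w / ν w ≤ c)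
    {g : EuclideanSpace ℝ (Fin d) → ℝ} (hg : Measurable g)
    (hgi : Integrable fun s => |g s| ^ 4 * ν s) (hgK : ∫ s, |g s| ^ 4 * ν s ≤ K) :
    Integrable (fun ω => g (W ω) ^ 4) P ∧ ∫ ω, g (W ω) ^ 4 ∂P ≤ c * K := by
  have habs (x : ℝ) : |x| ^ 4 = x ^ 4 := by rw [← abs_pow, abs_of_nonneg (by positivity)]
  simp_rw [habs] at hgi hgK
  have hK : 0 ≤ K := (integral_nonneg fun s =>
    mul_nonneg (show 0 ≤ g s ^ 4 by positivity) (hν.nonneg s)).trans hgK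
  have hν_meas := hν.measurable
  have hle : ∫⁻ ω, ENNReal.ofReal (g (W ω) ^ 4) ∂P ≤ ENNReal.ofReal (c * K) := by
    calc ∫⁻ ω, ENNReal.ofReal (g (W ω) ^ 4) ∂P
        = ∫⁻ w, ENNReal.ofReal (g w ^ 4) ∂(P.map W) :=
          (lintegral_map (f := fun w => ENNReal.ofReal (g w ^ 4)) (by fun_prop) hW).symm
      _ ≤ ∫⁻ w, ENNReal.ofReal (g w ^ 4) ∂(ENNReal.ofReal c • densityMeasure ν) :=
          lintegral_mono' (map_le_smul_densityMeasure hpW hν.measurable hc hpos) le_rfl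
      _ = ENNReal.ofReal c * ∫⁻ w, ENNReal.ofReal (g w ^ 4 * ν w) := by
          rw [lintegral_smul_measure, densityMeasure,
            lintegral_withDensity_eq_lintegral_mul _ (by fun_prop) (by fun_prop), smul_eq_mul]
          congr 1
          refine lintegral_congr fun w => ?_
          rw [Pi.mul_apply, mul_comm, ENNReal.ofReal_mul (by positivity)]
      _ = ENNReal.ofReal c * ENNReal.ofReal (∫ w, g w ^ 4 * ν w) := by
          rw [ofReal_integral_eq_lintegral_ofReal hgi (ae_of_all _ fun s =>
            mul_nonneg (show 0 ≤ g s ^ 4 by positivity) (hν.nonneg s))]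
      _ ≤ ENNReal.ofReal (c * K) := by
          rw [← ENNReal.ofReal_mul hc]
          exact ENNReal.ofReal_le_ofReal (mul_le_mul_of_nonneg_left hgK hc)
  have hmeas : Measurable fun ω => g (W ω) ^ 4 := by fun_prop
  have hnn : 0 ≤ᵐ[P] fun ω => g (W ω) ^ 4 :=
    ae_of_all _ fun ω => show (0 : ℝ) ≤ g (W ω) ^ 4 by positivity
  refine ⟨(lintegral_ofReal_ne_top_iff_integrable hmeas.aestronglyMeasurable hnn).1
    (hle.trans_lt ENNReal.ofReal_lt_top).ne, ?_⟩
  rw [integral_eq_lintegral_of_nonneg_ae hnn hmeas.aestronglyMeasurable]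
  exact ENNReal.toReal_le_of_le_ofReal (mul_nonneg hc hK) hle

theorem integral_sq_mul_le {U V : Ω → ℝ} (hU : AEMeasurable U P) (hV : AEMeasurable V P)
    (hU4 : Integrable (fun ω => U ω ^ 4) P) (hV4 : Integrable (fun ω => V ω ^ 4) P) :
    Integrable (fun ω => (U ω * V ω) ^ 2) P ∧
      ∫ ω, (U ω * V ω) ^ 2 ∂P ≤ (∫ ω, U ω ^ 4 ∂P + ∫ ω, V ω ^ 4 ∂P) / 2 := by
  have hb (ω : Ω) : (U ω * V ω) ^ 2 ≤ (U ω ^ 4 + V ω ^ 4) / 2 := by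
    nlinarith [sq_nonneg (U ω ^ 2 - V ω ^ 2)]
  have hi : Integrable (fun ω => (U ω ^ 4 + V ω ^ 4) / 2) P := (hU4.add hV4).div_const 2
  have h2 : Integrable (fun ω => (U ω * V ω) ^ 2) P := by
    refine hi.mono' (by fun_prop) (ae_of_all _ fun ω => ?_)
    rw [Real.norm_of_nonneg (sq_nonneg _)]
    exact hb ω
  refine ⟨h2, (integral_mono h2 hi hb).trans_eq ?_⟩
  rw [integral_div, integral_add hU4 hV4]

/-- An error with `E[U | W] = 0` is uncorrelated with functions of `W`. -/
theorem integral_mul_comp_eq_zero [IsProbabilityMeasure P] {U : Ω → ℝ} (hW : Measurable W)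
    (hU : Integrable U P) (hUW : condGiven P U W =ᵐ[P] 0) {g : EuclideanSpace ℝ (Fin d) → ℝ}
    (hg : Measurable g) (hUg : Integrable (fun ω => U ω * g (W ω)) P) :
    ∫ ω, U ω * g (W ω) ∂P = 0 := by
  have hle : MeasurableSpace.comap W inferInstance ≤ (inferInstance : MeasurableSpace Ω) :=
    hW.comap_le
  have hgW : StronglyMeasurable[MeasurableSpace.comap W inferInstance] (fun ω => g (W ω)) :=
    (hg.comp (comap_measurable W)).stronglyMeasurable
  have hUg' : Integrable ((fun ω => g (W ω)) * U) P := hUg.congr (ae_of_all _ fun ω => mul_comm _ _)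
  have h := condExp_mul_of_stronglyMeasurable_left hgW hUg' hU
  have h0 : P[(fun ω => g (W ω)) * U | MeasurableSpace.comap W inferInstance] =ᵐ[P] 0 := by
    filter_upwards [h, hUW] with ω h1 h2
    rw [h1, Pi.mul_apply]
    exact mul_eq_zero_of_right _ h2
  calc ∫ ω, U ω * g (W ω) ∂P = ∫ ω, ((fun ω => g (W ω)) * U) ω ∂P :=
        integral_congr_ae (ae_of_all _ fun ω => mul_comm _ _)
    _ = ∫ ω, (P[(fun ω => g (W ω)) * U | MeasurableSpace.comap W inferInstance]) ω ∂P :=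
        (integral_condExp hle).symm
    _ = 0 := by rw [integral_congr_ae h0]; simp

/-- The statistic `n S_n` is the squared norm of the first `m` coordinates of the normalized sum of
the vectors `((Y_i - φ₀(Z_i)) f_j^τ(W_i))_j`. -/
theorem nat_mul_testStat_eq {Ω' : Type*} {dz : ℕ} (Y : ℕ → Ω' → ℝ)
    (Z : ℕ → Ω' → EuclideanSpace ℝ (Fin dz)) (W : ℕ → Ω' → EuclideanSpace ℝ (Fin d))
    (φ₀ : EuclideanSpace ℝ (Fin dz) → ℝ) (f : ℕ → EuclideanSpace ℝ (Fin d) → ℝ) {τ : ℕ → ℝ}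
    (hτ : ∀ j, 0 ≤ τ j) (m n : ℕ) {ω : Ω'}
    (hω : ∀ i, Memℓp (fun j => (Y i ω - φ₀ (Z i ω)) * weightedBasis τ f j (W i ω)) 2) :
    (n : ℝ) * testStat Y Z W φ₀ f τ m n ω = ∑ j ∈ Finset.range m, ⟪stdBasisL2 j,
      normalizedSum (fun i ω => seqToL2 fun j =>
        (Y i ω - φ₀ (Z i ω)) * weightedBasis τ f j (W i ω)) n ω⟫_ℝ ^ 2 := by
  rw [testStat, Finset.mul_sum]
  refine Finset.sum_congr rfl fun j _ => ?_
  rw [inner_normalizedSum]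
  simp_rw [inner_stdBasisL2, seqToL2_apply (hω _), weightedBasis]
  have hsum : ∑ i ∈ Finset.range n, (Y i ω - φ₀ (Z i ω)) * (√(τ j) * f j (W i ω)) =
      √(τ j) * ∑ i ∈ Finset.range n, (Y i ω - φ₀ (Z i ω)) * f j (W i ω) := by
    rw [Finset.mul_sum]
    exact Finset.sum_congr rfl fun i _ => by ring
  rw [hsum, sq_abs, mul_pow, mul_pow, mul_pow, Real.sq_sqrt (hτ j), inv_pow, inv_pow,
    Real.sq_sqrt (Nat.cast_nonneg n)]
  rcases eq_or_ne n 0 with rfl | hn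
  · simp
  · field_simp

end Application

/-! ### The asymptotic null distribution -/

section NullDistribution

open scoped InnerProductSpace

/-- The sequence `(U f_j^τ(W))_j` is centred and has summable second moments. -/
theorem moments_error_mul_weightedBasis {Ω : Type*} [MeasurableSpace Ω] {P : Measure Ω}
    [IsProbabilityMeasure P] {d : ℕ} {U : Ω → ℝ} {W : Ω → EuclideanSpace ℝ (Fin d)}
    {pW ν : EuclideanSpace ℝ (Fin d) → ℝ} {f : ℕ → EuclideanSpace ℝ (Fin d) → ℝ} {τ : ℕ → ℝ}
    (hUm : Measurable U) (hW : Measurable W) (hU : Integrable U P) (hUW : condGiven P U W =ᵐ[P] 0)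
    (hU4 : Integrable (fun ω => U ω ^ 4) P) (hpW : IsDensityOf pW W P) (hν : IsProbDensity ν)
    (hf : ∀ l, Measurable (f l)) (hA1 : BasisCondition P W pW ν f) (hτ0 : ∀ j, 0 ≤ τ j)
    (hτs : Summable τ) :
    (∀ j, Integrable (fun ω => (U ω * weightedBasis τ f j (W ω)) ^ 2) P) ∧
      (Summable fun j => ∫ ω, (U ω * weightedBasis τ f j (W ω)) ^ 2 ∂P) ∧
      ∀ j, ∫ ω, U ω * weightedBasis τ f j (W ω) ∂P = 0 := by
  obtain ⟨ηf, ηp, -, hηp, hf4, hpos⟩ := hA1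
  have hW4 (j : ℕ) := integral_pow_four_comp_le hW hpW hν (zero_le_one.trans hηp) hpos (hf j)
    (hf4 j).1 (hf4 j).2
  have hUf (j : ℕ) := integral_sq_mul_le (V := fun ω => f j (W ω)) hUm.aemeasurable
    ((hf j).comp hW).aemeasurable hU4 (hW4 j).1
  have hsq (j : ℕ) : (fun ω => (U ω * weightedBasis τ f j (W ω)) ^ 2) =
      fun ω => τ j * (U ω * f j (W ω)) ^ 2 := by
    funext ω
    rw [weightedBasis, ← Real.sq_sqrt (hτ0 j), ← mul_pow, Real.sqrt_sq (Real.sqrt_nonneg _)]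
    ring
  have hint (j : ℕ) : Integrable (fun ω => (U ω * weightedBasis τ f j (W ω)) ^ 2) P := by
    rw [hsq j]; exact (hUf j).1.const_mul _
  refine ⟨hint, ?_, fun j => ?_⟩
  · refine (hτs.mul_right ((∫ ω, U ω ^ 4 ∂P + ηp * ηf) / 2)).of_nonneg_of_le
      (fun j => integral_nonneg fun ω => sq_nonneg _) fun j => ?_
    rw [hsq j, integral_const_mul]
    refine mul_le_mul_of_nonneg_left ((hUf j).2.trans ?_) (hτ0 j)
    linarith [(hW4 j).2]
  · have hwb : Measurable (weightedBasis τ f j) := (hf j).const_mul _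
    have hmem : MemLp (fun ω => U ω * weightedBasis τ f j (W ω)) 2 P :=
      (memLp_two_iff_integrable_sq (hUm.mul (hwb.comp hW)).aestronglyMeasurable).2 (hint j)
    exact integral_mul_comp_eq_zero hW hU hUW hwb (hmem.integrable one_le_two)

/-- Truncating the squared norm of the normalized sums at a number of coordinates that tends to
infinity does not affect its limit in probability. -/
theorem tendstoInMeasure_truncation {H : Type*} [NormedAddCommGroup H] [InnerProductSpace ℝ H]
    [CompleteSpace H] [SecondCountableTopology H] [MeasurableSpace H] [BorelSpace H]
    {Ω : Type*} [MeasurableSpace Ω] {P : Measure Ω} [IsProbabilityMeasure P]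
    {μ : Measure H} {X : ℕ → Ω → H} (hμ : MemLp id 2 μ) (hmean : ∫ x, x ∂μ = 0)
    (hX : ∀ i, HasLaw (X i) μ P) (hind : iIndepFun X P) (b : HilbertBasis ℕ ℝ H) {m : ℕ → ℕ}
    (hm : Tendsto m atTop atTop) :
    TendstoInMeasure P
      ((fun n ω => ∑ j ∈ Finset.range (m n), ⟪b j, normalizedSum X n ω⟫_ℝ ^ 2) -
        fun n ω => ‖normalizedSum X n ω‖ ^ 2) atTop 0 := by
  have hi (n : ℕ) := integrable_norm_sq_sub_sum hμ hX n b (Finset.range (m n))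
  have hbessel (n : ℕ) (x : H) : ∑ j ∈ Finset.range (m n), ⟪b j, x⟫_ℝ ^ 2 ≤ ‖x‖ ^ 2 := by
    simpa using b.orthonormal.sum_inner_products_le x (s := Finset.range (m n))
  have hneg (n : ℕ) : ((fun n ω => ∑ j ∈ Finset.range (m n), ⟪b j, normalizedSum X n ω⟫_ℝ ^ 2) -
      fun n ω => ‖normalizedSum X n ω‖ ^ 2) n =
      -fun ω => ‖normalizedSum X n ω‖ ^ 2 -
        ∑ j ∈ Finset.range (m n), ⟪b j, normalizedSum X n ω⟫_ℝ ^ 2 := by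
    funext ω
    simp
  refine tendstoInMeasure_of_tendsto_eLpNorm one_ne_zero (fun n => ?_)
    aestronglyMeasurable_zero ?_
  · rw [hneg]
    exact (hi n).neg.aestronglyMeasurable
  · have htr := ((hasSum_inner_covarianceOperator hμ b).tendsto_sum_nat.comp hm).const_sub
      (∫ x, ‖x‖ ^ 2 ∂μ)
    have h := ENNReal.tendsto_ofReal htr
    rw [sub_self, ENNReal.ofReal_zero] at h
    refine h.congr' ((eventually_ne_atTop 0).mono fun n hn => ?_)
    dsimp only
    rw [sub_zero, hneg, eLpNorm_neg, eLpNorm_one_eq_lintegral_enorm,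
      ← ofReal_integral_norm_eq_lintegral_enorm (hi n)]
    simp_rw [Real.norm_eq_abs]
    rw [integral_abs_norm_sq_sub_sum hμ hmean hX hind hn (hbessel n)]
    rfl

theorem mainTheorem2
    {Ω₀ Ω Ω' : Type*} [MeasurableSpace Ω₀] [MeasurableSpace Ω] [MeasurableSpace Ω']
    (P₀ : Measure Ω₀) [IsProbabilityMeasure P₀]
    (P : Measure Ω) [IsProbabilityMeasure P]
    (P' : Measure Ω') [IsProbabilityMeasure P']
    {dz dw : ℕ}
    -- the model `Y₀ = φ(Z₀) + U₀`, `E[U₀ | W₀] = 0`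
    (Y₀ : Ω₀ → ℝ) (Z₀ : Ω₀ → EuclideanSpace ℝ (Fin dz)) (W₀ : Ω₀ → EuclideanSpace ℝ (Fin dw))
    (φ : EuclideanSpace ℝ (Fin dz) → ℝ) (U₀ : Ω₀ → ℝ)
    (hmodel : IsNPIVModel P₀ Y₀ Z₀ W₀ φ U₀)
    -- an i.i.d. sample from it
    (Y : ℕ → Ω → ℝ) (Z : ℕ → Ω → EuclideanSpace ℝ (Fin dz))
    (W : ℕ → Ω → EuclideanSpace ℝ (Fin dw))
    (hsample : IsIIDSample P Y Z W P₀ Y₀ Z₀ W₀)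
    -- the density of `W₀`, the reference density `ν` and the orthonormal basis of `L²_ν`
    (pW ν : EuclideanSpace ℝ (Fin dw) → ℝ) (f : ℕ → EuclideanSpace ℝ (Fin dw) → ℝ)
    (hpW : IsDensityOf pW W₀ P₀) (hν : IsProbDensity ν) (hf : IsOrthonormalBasisL2 ν f)
    -- the four assumptions
    (hA1 : BasisCondition P₀ W₀ pW ν f)
    (hA2 : CondFourthMomentBounded P₀ U₀ W₀)
    (hA3 : CondExpOpNonsingular P₀ Z₀ W₀)
    (τ : ℕ → ℝ) (hA4 : WeightCondition τ)
    -- the truncation sequence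
    (m : ℕ → ℕ)
    (hτ : (fun n => ∑ j ∈ Finset.range (m n), τ j) =O[atTop] (fun _ => (1 : ℝ)))
    (hm : Tendsto m atTop atTop)
    -- the null hypothesis `φ = φ₀` in `L²_Z`
    (φ₀ : EuclideanSpace ℝ (Fin dz) → ℝ) (hφ₀ : Measurable φ₀)
    (hH0 : φ =ᵐ[P₀.map Z₀] φ₀)
    -- independent chi-square variables with one degree of freedom
    (χsq : ℕ → Ω' → ℝ) (hχind : iIndepFun χsq P') (hχlaw : ∀ j, HasLaw (χsq j) chiSquareOne P') :
    (∃ lam : ℕ → ℝ, IsOrderedEigenvalues (covMatrix P₀ U₀ W₀ τ f) lam) ∧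
    ∀ lam : ℕ → ℝ, IsOrderedEigenvalues (covMatrix P₀ U₀ W₀ τ f) lam →
      (∀ᵐ ω ∂P', Summable (fun j => lam j * χsq j ω)) ∧
      TendstoInDistribution (fun (n : ℕ) ω => (n : ℝ) * testStat Y Z W φ₀ f τ (m n) n ω) atTop
        (fun ω => ∑' j, lam j * χsq j ω) (fun _ => P) P' := by
  have hτ0 (j : ℕ) : 0 ≤ τ j := (hA4.1 j).le
  have hτs : Summable τ := summable_weights hτ0 hτ hm
  have hφm := hmodel.measurable_φ
  have hZm := hmodel.measurable_Z
  have hWm := hmodel.measurable_W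
  have hUm : Measurable U₀ := by
    have : U₀ = fun ω => Y₀ ω - φ (Z₀ ω) := by
      funext ω; rw [hmodel.error_eq ω]; ring
    rw [this]
    exact hmodel.measurable_Y.sub (hφm.comp hZm)
  have hwb (j : ℕ) : Measurable (weightedBasis τ f j) := (hf.1 j).const_mul _
  obtain ⟨hξi, hξs, hξ0⟩ := moments_error_mul_weightedBasis hUm hWm hmodel.integrable_error
    hmodel.condExp_error hA2.1 hpW hν hf.1 hA1 hτ0 hτs
  set ξ : ℕ → Ω₀ → ℝ := fun j ω => U₀ ω * weightedBasis τ f j (W₀ ω) with hξ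
  have hξm (j : ℕ) : Measurable (ξ j) := hUm.mul ((hwb j).comp hWm)
  have hL := memLp_seqToL2 hξm hξi hξs
  set μ : Measure (lp (fun _ : ℕ => ℝ) 2) := P₀.map fun ω => seqToL2 fun j => ξ j ω with hμdef
  have hμprob : IsProbabilityMeasure μ := Measure.isProbabilityMeasure_map hL.aemeasurable
  have hμ : MemLp id 2 μ := (memLp_map_measure_iff (by fun_prop) hL.aemeasurable).2 hL
  have hmean : ∫ x, x ∂μ = 0 := integral_map_seqToL2 hξm hξi hξs hξ0
  have heig (x : ℝ) := matrixEigenspace_eq_eigenspace (isSymmetric_covarianceOperator μ)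
    (S := covMatrix P₀ U₀ W₀ τ f)
    (fun j l => inner_covarianceOperator_map_seqToL2 hξm hξi hξs hξ0 j l) x
  refine ⟨?_, fun lam hlam => ?_⟩
  · obtain ⟨lam, h0, hanti, hmult⟩ := exists_orderedEigenvalues_covarianceOperator hμ
    refine ⟨lam, h0, hanti, fun x hx => ?_⟩
    rw [heig, ← hmult x hx, Cardinal.lift_id]
  -- under the null hypothesis the residuals `Y - φ₀(Z)` are copies of `U`
  have hgm : Measurable fun (p : ℝ × EuclideanSpace ℝ (Fin dz) × EuclideanSpace ℝ (Fin dw))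
      (j : ℕ) => (p.1 - φ₀ p.2.1) * weightedBasis τ f j p.2.2 := by
    refine measurable_pi_lambda _ fun j => ?_
    have := hwb j
    fun_prop
  have hres : ∀ᵐ ω ∂P₀, (fun j => (Y₀ ω - φ₀ (Z₀ ω)) * weightedBasis τ f j (W₀ ω)) =
      fun j => ξ j ω := by
    filter_upwards [ae_of_ae_map hZm.aemeasurable hH0] with ω hω
    funext j
    rw [hmodel.error_eq ω, hω, hξ]
    ring
  set X : ℕ → Ω → lp (fun _ : ℕ => ℝ) 2 := fun i ω => seqToL2 fun j =>
    (Y i ω - φ₀ (Z i ω)) * weightedBasis τ f j (W i ω) with hXdef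
  have hX (i : ℕ) : HasLaw (X i) μ P := by
    have h := (hsample.2 i).comp (measurable_seqToL2.comp hgm)
    refine ⟨h.aemeasurable_fst, h.map_eq.trans (Measure.map_congr ?_)⟩
    filter_upwards [hres] with ω hω
    simp only [Function.comp_apply]
    rw [hω]
  have hind : iIndepFun X P := hsample.1.comp (fun _ p => seqToL2 fun j =>
    (p.1 - φ₀ p.2.1) * weightedBasis τ f j p.2.2) fun _ => measurable_seqToL2.comp hgm
  have hmem : ∀ᵐ ω ∂P, ∀ i,
      Memℓp (fun j => (Y i ω - φ₀ (Z i ω)) * weightedBasis τ f j (W i ω)) 2 := by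
    refine ae_all_iff.2 fun i => ?_
    refine (hsample.2 i).symm.ae_mem_snd (hgm measurableSet_memℓp_two) ?_
    filter_upwards [hres, ae_memℓp_of_summable_integral_sq hξi hξs] with ω h1 h2
    simp only [Set.mem_preimage, Set.mem_ofPred_eq]
    rw [h1]
    exact h2
  have hmult (x : ℝ) (hx : x ≠ 0) : Cardinal.lift (Cardinal.mk {j : ℕ | lam j = x}) =
      Module.rank ℝ (Module.End.eigenspace
        (covarianceOperator μ : Module.End ℝ (lp (fun _ : ℕ => ℝ) 2)) x) := by
    rw [← heig, ← hlam.multiplicity x hx, Cardinal.lift_id]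
  obtain ⟨hsum, hclt⟩ := tendstoInDistribution_norm_sq_normalizedSum hμ hmean hX hind hlam.nonneg
    hmult hχind hχlaw
  refine ⟨ae_summable_mul_chiSquare hχlaw hlam.nonneg hsum, ?_⟩
  have htrunc := tendstoInMeasure_truncation hμ hmean hX hind stdBasisL2 hm
  refine (tendstoInDistribution_of_tendstoInMeasure_sub _ _ hclt htrunc fun n => ?_).congr
    (fun n => ?_) (ae_eq_refl _)
  · have := (memLp_normalizedSum hμ hX n).aemeasurable
    fun_prop
  · filter_upwards [hmem] with ω hω
    exact (nat_mul_testStat_eq Y Z W φ₀ f hτ0 (m n) n hω).symm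

end NullDistribution
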